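/- Define $F\colon[0,\infty)\to\mathbb{R}$ by $F(0)=0$, $F(r)=\int_0^r \frac{du}{-\log u}$ for $0<r\le e^{-2}$ and $F(r)=F(e^{-2})+\tfrac12(r-e^{-2})$ for $r\ge e^{-2}$. For $a>0$ and $\varepsilon>0$ let $f_{\varepsilon,a}\colon\mathbb{R}^2\to\mathbb{R}$, \[ f_{\varepsilon,a}(x_1,x_2)=F\Big(\sqrt{x_1^2+x_2^2}\Big)+\frac{\varepsilon}{2}\,(\max\{x_1-a,0\})^2 . \] By a *Nesterov trajectory* for $(\varepsilon,a)$ we mean a map $X\colon[0,\infty)\to\mathbb{R}^2$, of class $C^1$ on $[0,\infty)$ and $C^2$ on $(0,\infty)$, with \[ \ddot X(t)+\frac3t\dot X(t)+\nabla f_{\varepsilon,a}(X(t))=0\quad(t>0),\qquad X(0)=(2a,a),\qquad \dot X(0)=0 . \] For such an $X=(X_1,X_2)$ put $T_{\mathrm{rad}}=\sup\{t\ge0:\|X(t)\|>a\}$ and \[ \kappa=\varepsilon\int_0^{T_{\mathrm{rad}}}s^3X_2(s)\,\max\{X_1(s)-a,0\}\,ds . \] **Theorem.** Let $a>0$. 1.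 There is $\varepsilon_0>0$ such that for every $\varepsilon\in(0,\varepsilon_0)$ a Nesterov trajectory for $(\varepsilon,a)$ exists, and every such trajectory has $\kappa>0$. 2. For every $\varepsilon>0$ the function $f_{\varepsilon,a}$ is convex and $C^1$, $f_{\varepsilon,a}(0)=0$, and $f_{\varepsilon,a}(x)>0$ for $x\ne0$ (so $0$ is its unique minimizer and $\min f_{\varepsilon,a}=0$). Every Nesterov trajectory $X$ for $(\varepsilon,a)$ satisfies $X(t)\to0$ as $t\to\infty$, and if moreover $\kappa>0$, then \[ \int_0^\infty t\,f_{\varepsilon,a}(X(t))\,dt=\infty\qquad\text{and}\qquad \int_0^\infty t\,\|\dot X(t)\|^2\,dt=\infty . \] In particular, for every $a>0$ and all sufficiently small $\varepsilon>0$, Nesterov trajectories for $(\varepsilon,a)$ exist, and along each of them $X(t)\to 0$ while both weighted integrals are infinite. Hence point convergence of the Nesterov flow does not require these weighted integrals to be finite. -/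

import Mathlib

open Set Filter Topology MeasureTheory

noncomputable section

namespace NesterovFlow

/-- The Euclidean plane. -/
abbrev Plane : Type := EuclideanSpace ℝ (Fin 2)

/-- The radial profile `F` (only its values at `r ≥ 0` matter):
`F r = ∫₀ʳ du / (-log u)` for `0 ≤ r ≤ e⁻²` (so `F 0 = 0`), continued affinely with slope `1/2`. -/
def radialProfile (r : ℝ) : ℝ :=
  if r ≤ Real.exp (-2) then ∫ u in (0 : ℝ)..r, 1 / (-Real.log u)
  else (∫ u in (0 : ℝ)..Real.exp (-2), 1 / (-Real.log u)) + 1 / 2 * (r - Real.exp (-2))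

/-- The one-sided quadratic `Ψ_a(u) = (u - a)₊² / 2`. -/
def oneSidedQuadratic (a u : ℝ) : ℝ := 1 / 2 * (max (u - a) 0) ^ 2

/-- The potential `f_{ε,a}(x) = F(‖x‖) + ε Ψ_a(x₁)`. -/
def potential (ε a : ℝ) (x : Plane) : ℝ :=
  radialProfile ‖x‖ + ε * oneSidedQuadratic a (x 0)

/-- `X` is, on `[0, ∞)`, a global solution of `X'' + (3/t) X' + ∇f(X) = 0` for `t > 0`,
with `X(0) = x₀` and `X'(0) = 0`: it is `C¹` on `[0, ∞)` and `C²` on `(0, ∞)`.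
The values of `X` at negative times are irrelevant. -/
structure IsNesterovFlow (f : Plane → ℝ) (x₀ : Plane) (X : ℝ → Plane) : Prop where
  contDiffOn_one : ContDiffOn ℝ 1 X (Ici 0)
  contDiffOn_two : ContDiffOn ℝ 2 X (Ioi 0)
  initial_position : X 0 = x₀
  initial_velocity : derivWithin X (Ici 0) 0 = 0
  ode : ∀ t : ℝ, 0 < t → deriv (deriv X) t + (3 / t) • deriv X t + gradient f (X t) = 0

/-- The last time the trajectory is outside the disc of radius `a`,
`T_rad = sup {t ≥ 0 : ‖X(t)‖ > a}`. -/
def radialTime (a : ℝ) (X : ℝ → Plane) : ℝ := sSup {t : ℝ | 0 ≤ t ∧ a < ‖X t‖}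

/-- The created angular momentum `κ = ε ∫₀^{T_rad} s³ X₂(s) (X₁(s) - a)₊ ds`. -/
def createdMomentum (ε a : ℝ) (X : ℝ → Plane) : ℝ :=
  ε * ∫ s in (0 : ℝ)..radialTime a X, s ^ 3 * X s 1 * max (X s 0 - a) 0

end NesterovFlow

end

/-! The weight `t ^ 3` absorbs the friction: `t ^ 3` times the cross product of position and
velocity changes only through the push `ε (x₁ - a)₊`, which vanishes inside the disc of radius `a`.
After `radialTime` this weighted angular momentum is therefore frozen at `κ`.

If `κ > 0`, the trajectory cannot collapse too fast. The Lyapunov functional `t² f(X) + 2 ‖X + (t/2)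
V‖²` is nonincreasing and bounds `t ‖V‖`, and `κ ≤ t³ ‖X‖ ‖V‖` then forces `‖X‖ ≥ c / t²`. Since
`F(r)` is at least of order `r / (-log r)` near `0`, `t f(X)` is eventually at least a multiple of
`1 / (t log t)`, whose primitive `log log t` is unbounded (`exists_potential_lower_bound`,
`lintegral_eq_top`). A virial identity passes the divergence on to `t ‖V‖²`. The same functional
gives `t² f(X) ≤ 2 ‖x₀‖²`, hence `X → 0`.

For small `ε`, `κ > 0` follows from a sign argument (`coord_one_mul_push_nonneg`). Until the first
coordinate drops to a small `δ`, the path stays in a thin sector around the starting ray, with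
positive second coordinate. Friction meanwhile dissipates so much energy that the remainder is below
`F(a)`. The path then never leaves the disc again, so the integrand of `κ` is nowhere negative, and
it is positive at small times.

Existence needs a Peano argument, because the gradient is continuous but not Lipschitz at `0`:
delayed equations are solved by iteration, and a limit is extracted by compactness
(`exists_fixedPoint`). -/

noncomputable section

namespace NesterovFlow

/-! ### The radial profile: slope, convexity and growth. -/

/-- The slope of the radial profile, extended to a continuous function on `ℝ`. -/
def slope (r : ℝ) : ℝ := 1 / (-Real.log (min (max r 0) (Real.exp (-2))))

lemma slope_of_nonpos {r : ℝ} (hr : r ≤ 0) : slope r = 0 := by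
  simp [slope, max_eq_right hr, (Real.exp_pos (-2)).le]

lemma slope_of_mem {r : ℝ} (h0 : 0 ≤ r) (h1 : r ≤ Real.exp (-2)) :
    slope r = 1 / (-Real.log r) := by
  simp [slope, max_eq_left h0, min_eq_left h1]

lemma slope_of_ge {r : ℝ} (h1 : Real.exp (-2) ≤ r) : slope r = 1 / 2 := by
  simp [slope, max_eq_left ((Real.exp_pos (-2)).le.trans h1), min_eq_right h1]

lemma two_le_neg_log_min {r : ℝ} (hr : 0 < r) : 2 ≤ -Real.log (min r (Real.exp (-2))) := by
  have h := Real.log_le_log (lt_min hr (Real.exp_pos (-2))) (min_le_right r (Real.exp (-2)))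
  rw [Real.log_exp] at h
  linarith

lemma slope_of_pos {r : ℝ} (hr : 0 < r) : slope r = 1 / (-Real.log (min r (Real.exp (-2)))) := by
  simp [slope, max_eq_left hr.le]

lemma slope_pos {r : ℝ} (hr : 0 < r) : 0 < slope r := by
  rw [slope_of_pos hr]
  have := two_le_neg_log_min hr
  positivity

lemma slope_nonneg (r : ℝ) : 0 ≤ slope r := by
  rcases le_or_gt r 0 with h | h
  · rw [slope_of_nonpos h]
  · exact (slope_pos h).le

lemma slope_le_half (r : ℝ) : slope r ≤ 1 / 2 := by
  rcases le_or_gt r 0 with h | h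
  · rw [slope_of_nonpos h]; norm_num
  · rw [slope_of_pos h]
    exact one_div_le_one_div_of_le (by norm_num) (two_le_neg_log_min h)

lemma slope_monotone : Monotone slope := by
  intro r s hrs
  rcases le_or_gt r 0 with h | h
  · rw [slope_of_nonpos h]; exact slope_nonneg s
  · have hs := h.trans_le hrs
    rw [slope_of_pos h, slope_of_pos hs]
    refine one_div_le_one_div_of_le (by linarith [two_le_neg_log_min hs]) (neg_le_neg ?_)
    exact Real.log_le_log (lt_min h (Real.exp_pos _)) (min_le_min_right _ hrs)

lemma slope_continuous : Continuous slope := by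
  have hlog : ∀ u ∈ Icc (0 : ℝ) (Real.exp (-2)), ContinuousAt (fun u => 1 / (-Real.log u)) u := by
    intro u hu
    rcases hu.1.eq_or_lt with h | h
    · subst h
      -- The conventions `Real.log 0 = 0` and `1 / 0 = 0` give the value `0`, which is also the
      -- limit because `-log u → ∞`.
      rw [continuousAt_iff_punctured_nhds]
      have h1 : Tendsto (fun u : ℝ => -Real.log u) (𝓝[≠] 0) atTop :=
        tendsto_neg_atBot_atTop.comp Real.tendsto_log_nhdsNE_zero
      simpa [Pi.inv_def] using h1.inv_tendsto_atTop
    · have hl := Real.log_le_log h hu.2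
      rw [Real.log_exp] at hl
      exact continuousAt_const.div (Real.continuousAt_log h.ne').neg (by linarith)
  rw [continuous_iff_continuousAt]
  intro r
  have hmem : min (max r 0) (Real.exp (-2)) ∈ Icc (0 : ℝ) (Real.exp (-2)) :=
    ⟨le_min (le_max_right _ _) (Real.exp_pos _).le, min_le_right _ _⟩
  exact ContinuousAt.comp (f := fun r : ℝ => min (max r 0) (Real.exp (-2)))
    (g := fun u => 1 / (-Real.log u)) (hlog _ hmem) (by fun_prop)

/-- The radial profile, extended to a `C¹` function on `ℝ`. -/
def profile (r : ℝ) : ℝ := ∫ u in (0 : ℝ)..r, slope u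

lemma slope_integrable (a b : ℝ) : IntervalIntegrable slope volume a b :=
  slope_continuous.intervalIntegrable a b

lemma radialProfile_eq {r : ℝ} (hr : 0 ≤ r) : radialProfile r = profile r := by
  have key : ∀ s : ℝ, 0 ≤ s → s ≤ Real.exp (-2) →
      ∫ u in (0 : ℝ)..s, 1 / (-Real.log u) = ∫ u in (0 : ℝ)..s, slope u := by
    intro s h0 h1
    refine intervalIntegral.integral_congr fun u hu => ?_
    rw [uIcc_of_le h0] at hu
    exact (slope_of_mem hu.1 (hu.2.trans h1)).symm
  unfold radialProfile profile
  split_ifs with h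
  · exact key r hr h
  · push Not at h
    rw [key _ (Real.exp_pos _).le le_rfl,
      ← intervalIntegral.integral_add_adjacent_intervals (slope_integrable 0 (Real.exp (-2)))
        (slope_integrable _ r)]
    congr 1
    rw [intervalIntegral.integral_congr (g := fun _ => (1 / 2 : ℝ))]
    · simp [mul_comm]
    · intro u hu
      rw [uIcc_of_le h.le] at hu
      exact slope_of_ge hu.1

lemma profile_zero : profile 0 = 0 := by simp [profile]

lemma profile_hasDerivAt (r : ℝ) : HasDerivAt profile (slope r) r :=
  (slope_continuous.integral_hasStrictDerivAt 0 r).hasDerivAt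

lemma profile_deriv : deriv profile = slope := funext fun r => (profile_hasDerivAt r).deriv

lemma profile_continuous : Continuous profile :=
  continuous_iff_continuousAt.2 fun r => (profile_hasDerivAt r).continuousAt

lemma profile_monotone : Monotone profile :=
  monotone_of_deriv_nonneg (fun r => (profile_hasDerivAt r).differentiableAt)
    fun r => by rw [profile_deriv]; exact slope_nonneg r

lemma profile_nonneg {r : ℝ} (hr : 0 ≤ r) : 0 ≤ profile r := by
  rw [← profile_zero]; exact profile_monotone hr

lemma profile_convexOn : ConvexOn ℝ univ profile :=
  Monotone.convexOn_univ_of_deriv (fun r => (profile_hasDerivAt r).differentiableAt)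
    (by rw [profile_deriv]; exact slope_monotone)

/-- Only the mass on `[r / 2, r]` is kept, where the monotone slope is at least its value at `r /
2`. This is the lower bound of order `r / (-log r)` behind the divergence. -/
lemma half_mul_slope_half_le_profile {r : ℝ} (hr : 0 ≤ r) : r / 2 * slope (r / 2) ≤ profile r := by
  have h1 : profile r = profile (r / 2) + ∫ u in (r / 2)..r, slope u :=
    (intervalIntegral.integral_add_adjacent_intervals (slope_integrable _ _)
      (slope_integrable _ _)).symm
  have h2 : ∫ _u in (r / 2)..r, slope (r / 2) ≤ ∫ u in (r / 2)..r, slope u :=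
    intervalIntegral.integral_mono_on (by linarith) (by simp) (slope_integrable _ _)
      fun u hu => slope_monotone hu.1
  rw [intervalIntegral.integral_const, smul_eq_mul] at h2
  have h3 := profile_nonneg (r := r / 2) (by linarith)
  nlinarith

lemma profile_pos {r : ℝ} (hr : 0 < r) : 0 < profile r :=
  lt_of_lt_of_le (mul_pos (by linarith) (slope_pos (by linarith)))
    (half_mul_slope_half_le_profile hr.le)

/-- The difference of the two sides is monotone because the slope is at most `1 / 2`, and is
constant beyond `1 ≥ e⁻²`. This coercivity confines trajectories in the existence proof. -/
lemma profile_ge_linear (r : ℝ) : 1 / 2 * (r - 1) ≤ profile r := by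
  have hd : ∀ r, HasDerivAt (fun r => profile r - 1 / 2 * (r - 1)) (slope r - 1 / 2 * 1) r :=
    fun r => (profile_hasDerivAt r).sub (((hasDerivAt_id r).sub_const 1).const_mul _)
  have ha : Antitone (fun r => profile r - 1 / 2 * (r - 1)) :=
    antitone_of_deriv_nonpos (fun r => (hd r).differentiableAt) fun r => by
      rw [(hd r).deriv]; linarith [slope_le_half r]
  rcases le_or_gt r 1 with h1 | h1
  · have h2 := ha h1
    have h3 := profile_nonneg (r := 1) (by norm_num)
    simp only at h2
    linarith
  · have hm : MonotoneOn (fun r => profile r - 1 / 2 * (r - 1)) (Ici 1) := by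
      refine monotoneOn_of_deriv_nonneg (convex_Ici 1)
        (fun r _ => (hd r).continuousAt.continuousWithinAt)
        (fun r _ => (hd r).differentiableAt.differentiableWithinAt) fun r hr => ?_
      rw [interior_Ici, mem_Ioi] at hr
      rw [(hd r).deriv, slope_of_ge]
      · norm_num
      · exact (Real.exp_le_one_iff.2 (by norm_num)).trans hr.le
    have h2 := hm (mem_Ici.2 le_rfl) (mem_Ici.2 h1.le) h1.le
    have h3 := profile_nonneg (r := 1) (by norm_num)
    simp only at h2
    linarith

/-- Scaling by `c` lowers `-log` by at most `log c ≤ c - 1`, and the lowered value is still at least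
`2`. -/
lemma slope_mul_le {c u : ℝ} (hc : 1 ≤ c) (hu : 0 ≤ u) :
    slope (c * u) ≤ (1 + (c - 1) / 2) * slope u := by
  rcases hu.eq_or_lt with h | h
  · subst h; simp [slope_of_nonpos]
  have hcu : 0 < c * u := by positivity
  rw [slope_of_pos hcu, slope_of_pos h]
  have h1 := two_le_neg_log_min h
  have h2 := two_le_neg_log_min hcu
  have hle : min (c * u) (Real.exp (-2)) ≤ c * min u (Real.exp (-2)) := by
    rw [mul_min_of_nonneg _ _ (by linarith)]
    refine min_le_min_left _ ?_
    nlinarith [Real.exp_pos (-2)]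
  have h3 := Real.log_le_log (lt_min hcu (Real.exp_pos _)) hle
  rw [Real.log_mul (by positivity) (lt_min h (Real.exp_pos _)).ne'] at h3
  have h4 := Real.log_le_sub_one_of_pos (show 0 < c by linarith)
  rw [mul_one_div, div_le_div_iff₀ (by linarith) (by linarith)]
  nlinarith

lemma profile_mul_le {c r : ℝ} (hc : 1 ≤ c) (hr : 0 ≤ r) :
    profile (c * r) ≤ c * (1 + (c - 1) / 2) * profile r := by
  have h1 : profile (c * r) = c * ∫ u in (0 : ℝ)..r, slope (c * u) := by
    rw [intervalIntegral.mul_integral_comp_mul_left, mul_zero, profile]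
  have h2 : ∫ u in (0 : ℝ)..r, slope (c * u) ≤ ∫ u in (0 : ℝ)..r, (1 + (c - 1) / 2) * slope u :=
    intervalIntegral.integral_mono_on hr
      ((slope_continuous.comp (continuous_const_mul c)).intervalIntegrable _ _)
      ((slope_integrable _ _).const_mul _) fun u hu => slope_mul_le hc hu.1
  rw [intervalIntegral.integral_const_mul] at h2
  rw [h1, mul_assoc]
  exact mul_le_mul_of_nonneg_left h2 (by linarith)

/-- The exact factor is `(√5 + 5) / 2 ≈ 3.618`. The starting point has norm `√5 a`, so this compares
the initial energy with `profile a`. -/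
lemma profile_sqrt_five_mul_le {r : ℝ} (hr : 0 ≤ r) :
    profile (√5 * r) ≤ 3.62 * profile r := by
  have h5 : (√5 : ℝ) ^ 2 = 5 := Real.sq_sqrt (by norm_num)
  have h5n : 0 ≤ (√5 : ℝ) := Real.sqrt_nonneg 5
  have h1 : (1 : ℝ) ≤ √5 := by nlinarith
  have h2 : (√5 : ℝ) ≤ 2.24 := by nlinarith
  have := profile_mul_le h1 hr
  have h3 := profile_nonneg hr
  nlinarith

/-! ### The potential: gradient, regularity, convexity. -/

/-- The force `F'(‖x‖) x / ‖x‖ + ψ(x₁) e₁`. -/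
def force (ψ : ℝ → ℝ) (x : Plane) : Plane :=
  (slope ‖x‖ / ‖x‖) • x + EuclideanSpace.single 0 (ψ (x 0))

/-- The potential `F(‖x‖) + Ψ(x₁)`. -/
def generalPotential (Ψ : ℝ → ℝ) (x : Plane) : ℝ := profile ‖x‖ + Ψ (x 0)

/-- At the origin the formula reads `(0 / 0) • 0 = 0`, which is correct because the profile has
derivative `0` there. -/
lemma hasGradientAt_profile_norm (x : Plane) :
    HasGradientAt (fun x : Plane => profile ‖x‖) ((slope ‖x‖ / ‖x‖) • x) x := by
  rw [hasGradientAt_iff_hasFDerivAt]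
  rcases eq_or_ne x 0 with rfl | hx
  · have h0 : HasDerivAt profile 0 0 := by
      simpa [slope_of_nonpos] using profile_hasDerivAt 0
    simp only [smul_zero, map_zero]
    rw [hasDerivAt_iff_isLittleO_nhds_zero] at h0
    rw [hasFDerivAt_iff_isLittleO_nhds_zero]
    have h1 := h0.comp_tendsto (tendsto_norm_zero (E := Plane))
    refine (Asymptotics.isLittleO_norm_right.1 ?_)
    simpa [Function.comp_def, profile_zero] using h1
  · have hn : 0 < ‖x‖ := norm_pos_iff.2 hx
    have h1 : HasFDerivAt (fun x : Plane => √(‖x‖ ^ 2)) _ x :=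
      (hasStrictFDerivAt_norm_sq x).hasFDerivAt.sqrt (by positivity)
    simp only [Real.sqrt_sq (norm_nonneg _)] at h1
    refine ((profile_hasDerivAt ‖x‖).comp_hasFDerivAt x h1).congr_fderiv ?_
    ext y
    simp [InnerProductSpace.toDual_apply_apply]
    field_simp

lemma hasGradientAt_generalPotential {Ψ ψ : ℝ → ℝ} (h : ∀ u, HasDerivAt Ψ (ψ u) u) (x : Plane) :
    HasGradientAt (generalPotential Ψ) (force ψ x) x := by
  have h1 := (hasGradientAt_iff_hasFDerivAt.1 (hasGradientAt_profile_norm x))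
  have h2 : HasFDerivAt (fun y : Plane => Ψ (y 0)) _ x :=
    (h (x 0)).comp_hasFDerivAt x
      (EuclideanSpace.proj (𝕜 := ℝ) (0 : Fin 2)).hasFDerivAt
  rw [hasGradientAt_iff_hasFDerivAt]
  refine (h1.add h2).congr_fderiv ?_
  ext y
  simp [force, InnerProductSpace.toDual_apply_apply, EuclideanSpace.inner_single_left]

lemma centralForce_norm (x : Plane) : ‖(slope ‖x‖ / ‖x‖) • x‖ = slope ‖x‖ := by
  rcases eq_or_ne x 0 with rfl | hx
  · simp [slope_of_nonpos]
  · have hn : ‖x‖ ≠ 0 := norm_ne_zero_iff.2 hx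
    rw [norm_smul, norm_div, norm_norm, div_mul_cancel₀ _ hn, Real.norm_of_nonneg (slope_nonneg _)]

lemma force_continuous {ψ : ℝ → ℝ} (hψ : Continuous ψ) : Continuous (force ψ) := by
  refine Continuous.add ?_ ?_
  · rw [continuous_iff_continuousAt]
    intro x
    rcases eq_or_ne x 0 with rfl | hx
    · rw [ContinuousAt, smul_zero, tendsto_zero_iff_norm_tendsto_zero]
      simp only [centralForce_norm]
      have := (slope_continuous.comp (continuous_norm (E := Plane))).tendsto 0
      simpa [Function.comp_def, slope_of_nonpos] using this
    · exact ((slope_continuous.comp continuous_norm).continuousAt.div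
        continuous_norm.continuousAt (norm_ne_zero_iff.2 hx)).smul continuousAt_id
  · have h2 : Continuous fun x : Plane => ψ (x 0) :=
      hψ.comp (EuclideanSpace.proj (𝕜 := ℝ) (0 : Fin 2)).continuous
    exact (PiLp.continuous_toLp 2 _).comp (continuous_pi fun i => by
      fin_cases i <;> simp [h2, continuous_const])

lemma contDiff_generalPotential {Ψ ψ : ℝ → ℝ} (h : ∀ u, HasDerivAt Ψ (ψ u) u)
    (hψ : Continuous ψ) : ContDiff ℝ 1 (generalPotential Ψ) := by
  have hf : ∀ x, HasFDerivAt (generalPotential Ψ)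
      ((InnerProductSpace.toDual ℝ Plane) (force ψ x)) x :=
    fun x => hasGradientAt_iff_hasFDerivAt.1 (hasGradientAt_generalPotential h x)
  rw [contDiff_one_iff_fderiv]
  refine ⟨fun x => (hf x).differentiableAt, ?_⟩
  rw [show fderiv ℝ (generalPotential Ψ) = fun x => (InnerProductSpace.toDual ℝ Plane) (force ψ x)
    from funext fun x => (hf x).fderiv]
  exact (InnerProductSpace.toDual ℝ Plane).continuous.comp (force_continuous hψ)

lemma convexOn_generalPotential {Ψ : ℝ → ℝ} (h : ConvexOn ℝ univ Ψ) :
    ConvexOn ℝ univ (generalPotential Ψ) := by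
  refine ConvexOn.add ?_ ?_
  · exact (profile_convexOn.subset (subset_univ _) (by
      have : Convex ℝ ((fun x : Plane => ‖x‖) '' univ) := by
        refine Real.convex_iff_isPreconnected.2 ?_
        exact isPreconnected_univ.image _ continuous_norm.continuousOn
      exact this)).comp (convexOn_univ_norm) (profile_monotone.monotoneOn _)
  · exact h.comp_linearMap (EuclideanSpace.proj (𝕜 := ℝ) (0 : Fin 2)).toLinearMap

lemma hasDerivAt_oneSidedQuadratic (a u : ℝ) :
    HasDerivAt (oneSidedQuadratic a) (max (u - a) 0) u := by
  have key : ∀ u, HasDerivAt (fun u : ℝ => 1 / 2 * (max u 0) ^ 2) (max u 0) u := by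
    intro u
    rcases lt_trichotomy u 0 with h | h | h
    · rw [max_eq_right h.le]
      refine (hasDerivAt_const u (0 : ℝ)).congr_of_eventuallyEq ?_
      filter_upwards [Iio_mem_nhds h] with v hv
      rw [max_eq_right (le_of_lt hv)]; norm_num
    · subst h
      rw [max_self, hasDerivAt_iff_isLittleO_nhds_zero]
      refine Asymptotics.IsBigO.trans_isLittleO (g := fun h : ℝ => h ^ 2) ?_ ?_
      · refine Asymptotics.IsBigO.of_bound 1 (Eventually.of_forall fun v => ?_)
        have : (max v 0) ^ 2 ≤ v ^ 2 := by
          rcases le_total v 0 with h | h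
          · rw [max_eq_right h]; simpa using sq_nonneg v
          · rw [max_eq_left h]
        simp only [zero_add, max_self, smul_zero, sub_zero]
        rw [Real.norm_of_nonneg (by norm_num), Real.norm_of_nonneg (sq_nonneg v)]
        nlinarith [sq_nonneg v]
      · exact Asymptotics.isLittleO_pow_id one_lt_two
    · rw [max_eq_left h.le]
      have h1 : HasDerivAt (fun u : ℝ => 1 / 2 * u ^ 2) u u := by
        exact ((hasDerivAt_pow 2 u).const_mul (1 / 2 : ℝ)).congr_deriv (by norm_num; ring)
      refine h1.congr_of_eventuallyEq ?_
      filter_upwards [Ioi_mem_nhds h] with v hv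
      rw [max_eq_left (le_of_lt hv)]
  exact (key (u - a)).comp_sub_const u a

lemma oneSidedQuadratic_nonneg (a u : ℝ) : 0 ≤ oneSidedQuadratic a u := by
  unfold oneSidedQuadratic; positivity

lemma convexOn_oneSidedQuadratic (a : ℝ) : ConvexOn ℝ univ (oneSidedQuadratic a) := by
  refine Monotone.convexOn_univ_of_deriv
    (fun u => (hasDerivAt_oneSidedQuadratic a u).differentiableAt) ?_
  rw [show deriv (oneSidedQuadratic a) = fun u => max (u - a) 0 from
    funext fun u => (hasDerivAt_oneSidedQuadratic a u).deriv]
  exact fun u v h => max_le_max (by linarith) le_rfl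

/-- The perturbing force `ε (u - a)₊`. -/
def push (ε a u : ℝ) : ℝ := ε * max (u - a) 0

lemma push_continuous (ε a : ℝ) : Continuous (push ε a) := by unfold push; fun_prop

lemma potential_eq (ε a : ℝ) :
    potential ε a = generalPotential fun u => ε * oneSidedQuadratic a u := by
  ext x
  rw [potential, generalPotential, radialProfile_eq (norm_nonneg x)]

lemma hasGradientAt_potential (ε a : ℝ) (x : Plane) :
    HasGradientAt (potential ε a) (force (push ε a) x) x := by
  rw [potential_eq]
  exact hasGradientAt_generalPotential
    (fun u => (hasDerivAt_oneSidedQuadratic a u).const_mul ε) x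

lemma contDiff_potential (ε a : ℝ) : ContDiff ℝ 1 (potential ε a) := by
  rw [potential_eq]
  exact contDiff_generalPotential (fun u => (hasDerivAt_oneSidedQuadratic a u).const_mul ε)
    (push_continuous ε a)

lemma convexOn_potential {ε : ℝ} (hε : 0 ≤ ε) (a : ℝ) : ConvexOn ℝ univ (potential ε a) := by
  rw [potential_eq]
  exact convexOn_generalPotential ((convexOn_oneSidedQuadratic a).smul hε)

lemma potential_zero (ε : ℝ) {a : ℝ} (ha : 0 ≤ a) : potential ε a 0 = 0 := by
  simp [potential_eq, generalPotential, profile_zero, oneSidedQuadratic, ha]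

lemma profile_norm_le_potential {ε : ℝ} (hε : 0 ≤ ε) (a : ℝ) (x : Plane) :
    profile ‖x‖ ≤ potential ε a x := by
  rw [potential_eq, generalPotential]
  exact le_add_of_nonneg_right (mul_nonneg hε (oneSidedQuadratic_nonneg a _))

lemma potential_pos {ε : ℝ} (hε : 0 ≤ ε) (a : ℝ) {x : Plane} (hx : x ≠ 0) :
    0 < potential ε a x :=
  (profile_pos (norm_pos_iff.2 hx)).trans_le (profile_norm_le_potential hε a x)

/-- Along the ray `s ↦ s • x` the potential is convex and vanishes at `0`, so its chord slope over
`[0, 1]` is at most its derivative at `1`. -/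
lemma potential_le_inner {ε : ℝ} (hε : 0 ≤ ε) {a : ℝ} (ha : 0 ≤ a) (x : Plane) :
    potential ε a x ≤ inner ℝ (force (push ε a) x) x := by
  have hd : HasDerivAt (fun s : ℝ => potential ε a (s • x))
      (inner ℝ (force (push ε a) x) x) 1 := by
    have h1 := hasGradientAt_iff_hasFDerivAt.1 (hasGradientAt_potential ε a ((1 : ℝ) • x))
    have h2 : HasDerivAt (fun s : ℝ => s • x) x 1 := by
      simpa using (hasDerivAt_id (1 : ℝ)).smul_const x
    exact (h1.comp_hasDerivAt (1 : ℝ) h2).congr_deriv (by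
      rw [one_smul, InnerProductSpace.toDual_apply_apply])
  have hc : ConvexOn ℝ univ (fun s : ℝ => potential ε a (s • x)) :=
    (convexOn_potential hε a).comp_linearMap (LinearMap.toSpanSingleton ℝ Plane x)
  have := hc.slope_le_of_hasDerivAt (mem_univ 0) (mem_univ 1) one_pos hd
  simpa [_root_.slope, potential_zero ε ha] using this

/-! ### Solutions with explicit velocity: energy, Lyapunov and virial identities. -/

/-- `X` solves `X'' + (3/t) X' + G(X) = 0` on `[0, ∞)` with velocity `V`, from rest at `x₀`. -/
structure IsSolution (G : Plane → Plane) (x₀ : Plane) (X V : ℝ → Plane) : Prop where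
  continuousOn_position : ContinuousOn X (Ici 0)
  continuousOn_velocity : ContinuousOn V (Ici 0)
  initial_position : X 0 = x₀
  initial_velocity : V 0 = 0
  hasDerivAt_position : ∀ t : ℝ, 0 < t → HasDerivAt X (V t) t
  hasDerivAt_velocity : ∀ t : ℝ, 0 < t → HasDerivAt V (-(3 / t) • V t - G (X t)) t

lemma derivWithin_Ici_eq_deriv {X : ℝ → Plane} {t : ℝ} (ht : 0 < t) :
    derivWithin X (Ici 0) t = deriv X t :=
  derivWithin_of_mem_nhds (Ici_mem_nhds ht)

lemma IsNesterovFlow.isSolution {f : Plane → ℝ} {G : Plane → Plane} {x₀ : Plane} {X : ℝ → Plane}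
    (hX : IsNesterovFlow f x₀ X) (hG : ∀ x, HasGradientAt f (G x) x) :
    IsSolution G x₀ X (derivWithin X (Ici 0)) where
  continuousOn_position := hX.contDiffOn_one.continuousOn
  continuousOn_velocity :=
    hX.contDiffOn_one.continuousOn_derivWithin (uniqueDiffOn_Ici 0) le_rfl
  initial_position := hX.initial_position
  initial_velocity := hX.initial_velocity
  hasDerivAt_position t ht := by
    rw [derivWithin_Ici_eq_deriv ht]
    exact ((hX.contDiffOn_one.differentiableOn one_ne_zero).differentiableAt
      (Ici_mem_nhds ht)).hasDerivAt
  hasDerivAt_velocity t ht := by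
    have h2 : ContDiffOn ℝ (1 + 1) X (Ioi 0) := by
      simpa [one_add_one_eq_two] using hX.contDiffOn_two
    have h3 := ((contDiffOn_succ_iff_deriv_of_isOpen isOpen_Ioi).1 h2).2.2
    have h4 := ((h3.differentiableOn one_ne_zero).differentiableAt (Ioi_mem_nhds ht)).hasDerivAt
    have h5 := hX.ode t ht
    rw [(hG (X t)).gradient] at h5
    rw [derivWithin_Ici_eq_deriv ht]
    refine (h4.congr_deriv ?_).congr_of_eventuallyEq ?_
    · rw [neg_smul, sub_eq_add_neg, ← sub_eq_zero, ← h5]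
      abel
    · filter_upwards [Ioi_mem_nhds ht] with s hs
      exact derivWithin_Ici_eq_deriv hs

lemma hasDerivAt_coord {X : ℝ → Plane} {v : Plane} {t : ℝ} (h : HasDerivAt X v t) (i : Fin 2) :
    HasDerivAt (fun s => X s i) (v i) t :=
  (EuclideanSpace.proj (𝕜 := ℝ) i).hasFDerivAt.comp_hasDerivAt t h

lemma continuousOn_coord {X : ℝ → Plane} {s : Set ℝ} (h : ContinuousOn X s) (i : Fin 2) :
    ContinuousOn (fun t => X t i) s :=
  (EuclideanSpace.proj (𝕜 := ℝ) i).continuous.comp_continuousOn h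

lemma antitoneOn_of_hasDerivAt_nonpos {f f' : ℝ → ℝ} {D : Set ℝ} (hD : Convex ℝ D)
    (hc : ContinuousOn f D) (hd : ∀ x ∈ interior D, HasDerivAt f (f' x) x)
    (hn : ∀ x ∈ interior D, f' x ≤ 0) : AntitoneOn f D :=
  antitoneOn_of_deriv_nonpos hD hc
    (fun x hx => (hd x hx).differentiableAt.differentiableWithinAt)
    fun x hx => by rw [(hd x hx).deriv]; exact hn x hx

lemma monotoneOn_of_hasDerivAt_nonneg {f f' : ℝ → ℝ} {D : Set ℝ} (hD : Convex ℝ D)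
    (hc : ContinuousOn f D) (hd : ∀ x ∈ interior D, HasDerivAt f (f' x) x)
    (hn : ∀ x ∈ interior D, 0 ≤ f' x) : MonotoneOn f D :=
  monotoneOn_of_deriv_nonneg hD hc
    (fun x hx => (hd x hx).differentiableAt.differentiableWithinAt)
    fun x hx => by rw [(hd x hx).deriv]; exact hn x hx

namespace IsSolution

section General

variable {f : Plane → ℝ} {G : Plane → Plane} {x₀ : Plane} {X V : ℝ → Plane}

lemma hasDerivAt_comp (hX : IsSolution G x₀ X V) (hG : ∀ x, HasGradientAt f (G x) x) {t : ℝ}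
    (ht : 0 < t) : HasDerivAt (fun t => f (X t)) (inner ℝ (G (X t)) (V t)) t :=
  ((hasGradientAt_iff_hasFDerivAt.1 (hG (X t))).comp_hasDerivAt t
    (hX.hasDerivAt_position t ht)).congr_deriv (by rw [InnerProductSpace.toDual_apply_apply])

lemma continuousOn_comp (hX : IsSolution G x₀ X V) (hG : ∀ x, HasGradientAt f (G x) x) :
    ContinuousOn (fun t => f (X t)) (Ici 0) :=
  (continuous_iff_continuousAt.2 fun x => (hG x).continuousAt).comp_continuousOn
    hX.continuousOn_position

lemma hasDerivAt_energy (hX : IsSolution G x₀ X V) (hG : ∀ x, HasGradientAt f (G x) x) {t : ℝ}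
    (ht : 0 < t) :
    HasDerivAt (fun t => 1 / 2 * ‖V t‖ ^ 2 + f (X t)) (-(3 / t * ‖V t‖ ^ 2)) t := by
  refine (((hX.hasDerivAt_velocity t ht).norm_sq.const_mul (1 / 2)).add
    (hX.hasDerivAt_comp hG ht)).congr_deriv ?_
  rw [inner_sub_right, inner_smul_right, real_inner_self_eq_norm_sq, real_inner_comm (V t)]
  ring

lemma continuousOn_energy (hX : IsSolution G x₀ X V) (hG : ∀ x, HasGradientAt f (G x) x) :
    ContinuousOn (fun t => 1 / 2 * ‖V t‖ ^ 2 + f (X t)) (Ici 0) :=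
  (continuousOn_const.mul (hX.continuousOn_velocity.norm.pow 2)).add (hX.continuousOn_comp hG)

lemma energy_antitoneOn (hX : IsSolution G x₀ X V) (hG : ∀ x, HasGradientAt f (G x) x) :
    AntitoneOn (fun t => 1 / 2 * ‖V t‖ ^ 2 + f (X t)) (Ici 0) := by
  refine antitoneOn_of_hasDerivAt_nonpos (convex_Ici 0) (hX.continuousOn_energy hG)
    (fun t ht => hX.hasDerivAt_energy hG (by simpa using ht)) fun t ht => ?_
  rw [interior_Ici, mem_Ioi] at ht
  have : 0 ≤ 3 / t * ‖V t‖ ^ 2 := by positivity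
  linarith

/-- The friction coefficient `3` cancels all velocity terms in the derivative of `X + (t / 2) V`,
leaving `-(t / 2) G(X)`. The whole functional then has derivative `2 t (f - ⟨G, X⟩)`. -/
lemma lyapunov_antitoneOn (hX : IsSolution G x₀ X V) (hG : ∀ x, HasGradientAt f (G x) x)
    (hf : ∀ x, f x ≤ inner ℝ (G x) x) :
    AntitoneOn (fun t => t ^ 2 * f (X t) + 2 * ‖X t + (t / 2) • V t‖ ^ 2) (Ici 0) := by
  have hd : ∀ t ∈ interior (Ici (0 : ℝ)), HasDerivAt
      (fun t => t ^ 2 * f (X t) + 2 * ‖X t + (t / 2) • V t‖ ^ 2)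
      (2 * t * (f (X t) - inner ℝ (G (X t)) (X t))) t := by
    intro t ht
    rw [interior_Ici, mem_Ioi] at ht
    have h1 : HasDerivAt (fun t => X t + (t / 2) • V t) (-(t / 2) • G (X t)) t := by
      refine ((hX.hasDerivAt_position t ht).add
        (((hasDerivAt_id t).div_const 2).smul (hX.hasDerivAt_velocity t ht))).congr_deriv ?_
      simp only [id]
      rw [smul_sub, smul_smul, show t / 2 * -(3 / t) = -(3 / 2) by field_simp]
      module
    refine (((hasDerivAt_pow 2 t).mul (hX.hasDerivAt_comp hG ht)).add
      (h1.norm_sq.const_mul 2)).congr_deriv ?_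
    rw [inner_smul_right, inner_add_left, inner_smul_left, real_inner_comm (G (X t)) (X t),
      real_inner_comm (G (X t)) (V t)]
    simp
    ring
  refine antitoneOn_of_hasDerivAt_nonpos (convex_Ici 0) ?_ hd fun t ht => ?_
  · refine ((continuousOn_pow 2).mul (hX.continuousOn_comp hG)).add
      (continuousOn_const.mul ((hX.continuousOn_position.add
        ((continuousOn_id.div_const 2).smul hX.continuousOn_velocity)).norm.pow 2))
  · rw [interior_Ici, mem_Ioi] at ht
    have := hf (X t)
    nlinarith

lemma lyapunov_le (hX : IsSolution G x₀ X V) (hG : ∀ x, HasGradientAt f (G x) x)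
    (hf : ∀ x, f x ≤ inner ℝ (G x) x) {t : ℝ} (ht : 0 ≤ t) :
    t ^ 2 * f (X t) + 2 * ‖X t + (t / 2) • V t‖ ^ 2 ≤ 2 * ‖x₀‖ ^ 2 := by
  simpa [hX.initial_position] using hX.lyapunov_antitoneOn hG hf (mem_Ici.2 le_rfl) ht ht

/-- The differentiated quantity tends to `0` along the trajectories studied here, so divergence of
the weighted potential integral passes to the weighted kinetic one. -/
lemma hasDerivAt_virial (hX : IsSolution G x₀ X V) {t : ℝ} (ht : 0 < t) :
    HasDerivAt (fun t => t * inner ℝ (X t) (V t) + ‖X t‖ ^ 2)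
      (t * ‖V t‖ ^ 2 - t * inner ℝ (G (X t)) (X t)) t := by
  have h1 := hX.hasDerivAt_position t ht
  refine (((hasDerivAt_id t).mul (h1.inner ℝ (hX.hasDerivAt_velocity t ht))).add
    h1.norm_sq).congr_deriv ?_
  rw [inner_sub_right, inner_smul_right, real_inner_self_eq_norm_sq,
    real_inner_comm (G (X t)) (X t)]
  simp only [id]
  field_simp
  ring

end General

/-! ### Weighted angular momentum and convergence to the origin. -/

section Radial

variable {ψ : ℝ → ℝ} {x₀ : Plane} {X V : ℝ → Plane}

/-- The weighted angular momentum. -/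
def momentum (X V : ℝ → Plane) (t : ℝ) : ℝ := t ^ 3 * (X t 0 * V t 1 - X t 1 * V t 0)

lemma momentum_zero (X V : ℝ → Plane) : momentum X V 0 = 0 := by simp [momentum]

lemma momentum_le (X V : ℝ → Plane) {t : ℝ} (ht : 0 ≤ t) :
    momentum X V t ≤ t ^ 3 * (‖X t‖ * ‖V t‖) := by
  refine mul_le_mul_of_nonneg_left ?_ (by positivity)
  refine abs_le_of_sq_le_sq' ?_ (by positivity) |>.2
  rw [mul_pow, EuclideanSpace.norm_sq_eq, EuclideanSpace.norm_sq_eq]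
  simp only [Fin.sum_univ_two, Real.norm_eq_abs, sq_abs]
  nlinarith [sq_nonneg (X t 0 * V t 0 + X t 1 * V t 1)]

/-- The weight `t ^ 3` cancels the friction and a central force has no torque, so only `ψ`
contributes. -/
lemma hasDerivAt_momentum (hX : IsSolution (force ψ) x₀ X V) {t : ℝ} (ht : 0 < t) :
    HasDerivAt (momentum X V) (t ^ 3 * (X t 1 * ψ (X t 0))) t := by
  have hx := fun i => hasDerivAt_coord (hX.hasDerivAt_position t ht) i
  have hv := fun i => hasDerivAt_coord (hX.hasDerivAt_velocity t ht) i
  refine ((hasDerivAt_pow 3 t).mul (((hx 0).mul (hv 1)).sub ((hx 1).mul (hv 0)))).congr_deriv ?_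
  simp [force]
  field_simp
  ring

lemma continuousOn_momentum (hX : IsSolution (force ψ) x₀ X V) :
    ContinuousOn (momentum X V) (Ici 0) :=
  (continuousOn_pow 3).mul
    (((continuousOn_coord hX.continuousOn_position 0).mul
      (continuousOn_coord hX.continuousOn_velocity 1)).sub
    ((continuousOn_coord hX.continuousOn_position 1).mul
      (continuousOn_coord hX.continuousOn_velocity 0)))

end Radial

section Push

variable {ε a : ℝ} {x₀ : Plane} {X V : ℝ → Plane}

lemma tendsto_zero (hX : IsSolution (force (push ε a)) x₀ X V) (hε : 0 ≤ ε) (ha : 0 ≤ a) :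
    Tendsto X atTop (𝓝 0) := by
  rw [tendsto_zero_iff_norm_tendsto_zero]
  have hb : ∀ t, 0 ≤ t → t ^ 2 * profile ‖X t‖ ≤ 2 * ‖x₀‖ ^ 2 := fun t ht => by
    have h1 := hX.lyapunov_le (hasGradientAt_potential ε a) (potential_le_inner hε ha) ht
    have h2 := mul_le_mul_of_nonneg_left (profile_norm_le_potential hε a (X t)) (sq_nonneg t)
    nlinarith [sq_nonneg ‖X t + (t / 2) • V t‖]
  rw [Metric.tendsto_atTop]
  intro η hη
  have hp := profile_pos hη
  refine ⟨2 * ‖x₀‖ ^ 2 / profile η + 1, fun t ht => ?_⟩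
  rw [dist_zero_right, norm_norm]
  by_contra! hcon
  have h0 : 0 ≤ 2 * ‖x₀‖ ^ 2 / profile η := by positivity
  have h1 := hb t (by linarith)
  have h2 := profile_monotone hcon
  have h3 : 2 * ‖x₀‖ ^ 2 / profile η < t ^ 2 := by nlinarith
  rw [div_lt_iff₀ hp] at h3
  nlinarith [sq_nonneg t]

lemma radialTime_nonneg (a : ℝ) (X : ℝ → Plane) : 0 ≤ radialTime a X :=
  Real.sSup_nonneg fun _ h => h.1

lemma bddAbove_radial (h : Tendsto X atTop (𝓝 0)) (ha : 0 < a) :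
    BddAbove {t : ℝ | 0 ≤ t ∧ a < ‖X t‖} := by
  have h1 : ∀ᶠ t in atTop, ‖X t‖ < a := by
    have := (tendsto_zero_iff_norm_tendsto_zero.1 h).eventually (gt_mem_nhds ha)
    exact this
  obtain ⟨T, hT⟩ := eventually_atTop.1 h1
  refine ⟨T, fun t ht => ?_⟩
  by_contra! hlt
  exact lt_asymm (hT t hlt.le) ht.2

lemma norm_le_of_radialTime_lt (h : Tendsto X atTop (𝓝 0)) (ha : 0 < a) {t : ℝ}
    (ht : radialTime a X < t) : ‖X t‖ ≤ a := by
  by_contra! hlt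
  exact not_le.2 ht (le_csSup (bddAbove_radial h ha)
    ⟨(radialTime_nonneg a X).trans ht.le, hlt⟩)

lemma coord_le_norm (x : Plane) (i : Fin 2) : x i ≤ ‖x‖ :=
  (le_abs_self _).trans (PiLp.norm_apply_le x i)

lemma continuousOn_momentumRate (hX : IsSolution (force (push ε a)) x₀ X V) :
    ContinuousOn (fun s => s ^ 3 * X s 1 * max (X s 0 - a) 0) (Ici 0) :=
  ((continuousOn_pow 3).mul (continuousOn_coord hX.continuousOn_position 1)).mul
    (ContinuousOn.sup ((continuousOn_coord hX.continuousOn_position 0).sub continuousOn_const)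
      continuousOn_const)

lemma createdMomentum_eq (hX : IsSolution (force (push ε a)) x₀ X V) :
    createdMomentum ε a X = momentum X V (radialTime a X) := by
  have hT := radialTime_nonneg a X
  rw [createdMomentum, ← intervalIntegral.integral_const_mul,
    intervalIntegral.integral_eq_sub_of_hasDerivAt_of_le hT (f := momentum X V)
    (hX.continuousOn_momentum.mono Icc_subset_Ici_self), momentum_zero, sub_zero]
  · intro t ht
    refine (hX.hasDerivAt_momentum ht.1).congr_deriv ?_
    rw [push]; ring
  · refine ContinuousOn.intervalIntegrable ?_
    rw [uIcc_of_le hT]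
    exact continuousOn_const.mul (hX.continuousOn_momentumRate.mono Icc_subset_Ici_self)

/-- Past `radialTime` the norm, hence the first coordinate, is at most `a`, so the push is off and
the momentum is constant. -/
lemma momentum_eq_createdMomentum (hX : IsSolution (force (push ε a)) x₀ X V)
    (h : Tendsto X atTop (𝓝 0)) (ha : 0 < a) {t : ℝ} (ht : radialTime a X ≤ t) :
    momentum X V t = createdMomentum ε a X := by
  rw [createdMomentum_eq hX]
  have hT := radialTime_nonneg a X
  have hd : ∀ s ∈ interior (Ici (radialTime a X)), HasDerivAt (momentum X V) 0 s := by
    intro s hs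
    rw [interior_Ici, mem_Ioi] at hs
    refine (hX.hasDerivAt_momentum (hT.trans_lt hs)).congr_deriv ?_
    have := (coord_le_norm (X s) 0).trans (norm_le_of_radialTime_lt h ha hs)
    rw [push, max_eq_right (by linarith)]; ring
  have hc := hX.continuousOn_momentum.mono (Ici_subset_Ici.2 hT)
  have h1 := antitoneOn_of_hasDerivAt_nonpos (convex_Ici _) hc hd (fun _ _ => le_rfl)
    (mem_Ici.2 le_rfl) ht ht
  have h2 := monotoneOn_of_hasDerivAt_nonneg (convex_Ici _) hc hd (fun _ _ => le_rfl)
    (mem_Ici.2 le_rfl) ht ht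
  exact le_antisymm h1 h2

end Push

end IsSolution

/-! ### Divergence of the weighted integrals. -/

lemma lintegral_eq_top_of_tendsto_atTop {g W W' : ℝ → ℝ} {T : ℝ} (hT : 0 ≤ T)
    (hg : ContinuousOn g (Ici T)) (hg0 : ∀ t ≥ T, 0 ≤ g t)
    (hW : ∀ t ≥ T, HasDerivAt W (W' t) t) (hle : ∀ t ≥ T, W' t ≤ g t)
    (htop : Tendsto W atTop atTop) :
    ∫⁻ t in Ioi (0 : ℝ), ENNReal.ofReal (g t) = ⊤ := by
  have hlow : ∀ R ≥ T, ENNReal.ofReal (W R - W T) ≤ ∫⁻ t in Ioi (0 : ℝ), ENNReal.ofReal (g t) := by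
    intro R hR
    have hgR : ContinuousOn g (Icc T R) := hg.mono Icc_subset_Ici_self
    have h1 : W R - W T ≤ ∫ t in T..R, g t :=
      intervalIntegral.sub_le_integral_of_hasDeriv_right_of_le hR
        (fun t ht => (hW t ht.1).continuousAt.continuousWithinAt)
        (fun t ht => (hW t ht.1.le).hasDerivWithinAt) hgR.integrableOn_Icc
        (fun t ht => hle t ht.1.le)
    rw [intervalIntegral.integral_of_le hR] at h1
    have h2 : ENNReal.ofReal (∫ t in Ioc T R, g t) = ∫⁻ t in Ioc T R, ENNReal.ofReal (g t) :=
      ofReal_integral_eq_lintegral_ofReal (hgR.integrableOn_Icc.mono_set Ioc_subset_Icc_self)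
        ((ae_restrict_iff' measurableSet_Ioc).2 (Eventually.of_forall fun t ht => hg0 t ht.1.le))
    calc ENNReal.ofReal (W R - W T) ≤ ENNReal.ofReal (∫ t in Ioc T R, g t) :=
          ENNReal.ofReal_le_ofReal h1
      _ = ∫⁻ t in Ioc T R, ENNReal.ofReal (g t) := h2
      _ ≤ _ := lintegral_mono_set fun t ht => hT.trans_lt ht.1
  refine ENNReal.eq_top_of_forall_nnreal_le fun r => ?_
  obtain ⟨R, hR, hRW⟩ := ((eventually_ge_atTop T).and
    (htop.eventually_ge_atTop (W T + r))).exists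
  refine le_trans ?_ (hlow R hR)
  rw [← ENNReal.ofReal_coe_nnreal]
  exact ENNReal.ofReal_le_ofReal (by linarith)

lemma hasDerivAt_log_log {t : ℝ} (ht : 1 < t) :
    HasDerivAt (fun t => Real.log (Real.log t)) (1 / (t * Real.log t)) t := by
  have h := Real.log_pos ht
  refine ((Real.hasDerivAt_log (by linarith)).log h.ne').congr_deriv ?_
  field_simp

namespace IsSolution

variable {ε a : ℝ} {x₀ : Plane} {X V : ℝ → Plane}

/-- The Lyapunov bound gives `‖X + (t / 2) V‖ ≤ ‖x₀‖`; the triangle inequality then isolates `V`. -/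
lemma mul_norm_velocity_le (hX : IsSolution (force (push ε a)) x₀ X V) (hε : 0 ≤ ε) (ha : 0 ≤ a)
    {t : ℝ} (ht : 0 ≤ t) : t * ‖V t‖ ≤ 2 * (‖x₀‖ + ‖X t‖) := by
  have h1 := hX.lyapunov_le (hasGradientAt_potential ε a) (potential_le_inner hε ha) ht
  have h2 : 0 ≤ t ^ 2 * potential ε a (X t) := mul_nonneg (sq_nonneg t)
    ((profile_nonneg (norm_nonneg _)).trans (profile_norm_le_potential hε a (X t)))
  have h3 : ‖X t + (t / 2) • V t‖ ≤ ‖x₀‖ :=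
    le_of_sq_le_sq (by linarith) (norm_nonneg _)
  have h4 : ‖(t / 2) • V t‖ ≤ ‖X t + (t / 2) • V t‖ + ‖X t‖ := by
    simpa using norm_sub_le (X t + (t / 2) • V t) (X t)
  rw [norm_smul, Real.norm_of_nonneg (by linarith)] at h4
  linarith

lemma exists_potential_lower_bound (hX : IsSolution (force (push ε a)) x₀ X V) (hε : 0 ≤ ε)
    (ha : 0 < a) (hκ : 0 < createdMomentum ε a X) :
    ∃ c > 0, ∀ᶠ t in atTop, c * (1 / (t * Real.log t)) ≤ t * potential ε a (X t) := by
  have hlim := hX.tendsto_zero hε ha.le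
  have hlimn := tendsto_zero_iff_norm_tendsto_zero.1 hlim
  have hC : 0 < 2 * (‖x₀‖ + 1) := by positivity
  set C := 2 * (‖x₀‖ + 1) with hCdef
  set c := createdMomentum ε a X / C with hc
  have hc0 : 0 < c := div_pos hκ hC
  refine ⟨c / 6, by positivity, ?_⟩
  filter_upwards [eventually_gt_atTop 1, eventually_ge_atTop (radialTime a X),
    hlimn.eventually (gt_mem_nhds one_pos), hlimn.eventually (gt_mem_nhds (Real.exp_pos (-2))),
    Real.tendsto_log_atTop.eventually_ge_atTop (-Real.log (c / 2))] with t h1 hT hr1 hre hlog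
  have h0 : 0 < t := by linarith
  have hlt := Real.log_pos h1
  have hv : t * ‖V t‖ ≤ C := (hX.mul_norm_velocity_le hε ha.le h0.le).trans (by
    rw [hCdef]; linarith)
  have hL := momentum_le X V h0.le
  rw [hX.momentum_eq_createdMomentum hlim ha hT] at hL
  -- From `κ ≤ t³ ‖X‖ ‖V‖` and `t ‖V‖ ≤ C`.
  have hr : c ≤ t ^ 2 * ‖X t‖ := by
    rw [hc, div_le_iff₀ hC]
    refine hL.trans ?_
    have := mul_le_mul_of_nonneg_left hv (show 0 ≤ t ^ 2 * ‖X t‖ by positivity)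
    nlinarith
  have hr' : c / 2 / t ^ 2 ≤ ‖X t‖ / 2 := by
    rw [div_le_iff₀ (by positivity)]; linarith
  have hq : 0 < c / 2 / t ^ 2 := by positivity
  -- The left side is at most `2 log t - log (c / 2)`, and `t` is late enough that the last term
  -- costs at most another `log t`.
  have hl : -Real.log (‖X t‖ / 2) ≤ 3 * Real.log t := by
    have h := Real.log_le_log hq hr'
    rw [Real.log_div (by positivity) (by positivity), Real.log_pow] at h
    push_cast at h
    linarith
  have hpos : 0 < ‖X t‖ / 2 := hq.trans_le hr'
  have hs : 1 / (3 * Real.log t) ≤ slope (‖X t‖ / 2) := by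
    rw [slope_of_mem hpos.le (by linarith)]
    refine one_div_le_one_div_of_le ?_ hl
    have := Real.log_neg hpos (by linarith)
    linarith
  have hp : c / 2 / t ^ 2 * (1 / (3 * Real.log t)) ≤ potential ε a (X t) :=
    (mul_le_mul hr' hs (by positivity) hpos.le).trans
      ((half_mul_slope_half_le_profile (norm_nonneg _)).trans
        (profile_norm_le_potential hε a (X t)))
  refine le_trans (le_of_eq ?_) (mul_le_mul_of_nonneg_left hp h0.le)
  field_simp
  norm_num

lemma lintegral_eq_top (hX : IsSolution (force (push ε a)) x₀ X V) (hε : 0 ≤ ε)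
    (ha : 0 < a) (hκ : 0 < createdMomentum ε a X) :
    ∫⁻ t in Ioi (0 : ℝ), ENNReal.ofReal (t * potential ε a (X t)) = ⊤ ∧
    ∫⁻ t in Ioi (0 : ℝ), ENNReal.ofReal (t * ‖V t‖ ^ 2) = ⊤ := by
  obtain ⟨c, hc, hev⟩ := hX.exists_potential_lower_bound hε ha hκ
  obtain ⟨T, hT⟩ := eventually_atTop.1 (hev.and (eventually_gt_atTop 1))
  have hT1 : 1 < T := (hT T le_rfl).2
  have hT0 : 0 ≤ T := by linarith
  have hW : Tendsto (fun t => c * Real.log (Real.log t)) atTop atTop :=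
    (Real.tendsto_log_atTop.comp Real.tendsto_log_atTop).const_mul_atTop hc
  have hWd : ∀ t ≥ T, HasDerivAt (fun t => c * Real.log (Real.log t))
      (c * (1 / (t * Real.log t))) t :=
    fun t ht => (hasDerivAt_log_log (hT t ht).2).const_mul c
  have hsub : Ici T ⊆ Ici (0 : ℝ) := Ici_subset_Ici.2 hT0
  constructor
  · refine lintegral_eq_top_of_tendsto_atTop hT0 ?_ ?_ hWd (fun t ht => (hT t ht).1) hW
    · exact continuousOn_id.mul
        ((hX.continuousOn_comp (hasGradientAt_potential ε a)).mono hsub)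
    · intro t ht
      exact mul_nonneg (hT0.trans ht) ((profile_nonneg (norm_nonneg _)).trans
        (profile_norm_le_potential hε a (X t)))
  · have hlim := tendsto_zero_iff_norm_tendsto_zero.1 (hX.tendsto_zero hε ha.le)
    have hvir : Tendsto (fun t => t * inner ℝ (X t) (V t) + ‖X t‖ ^ 2) atTop (𝓝 0) := by
      have h1 : Tendsto (fun t => t * inner ℝ (X t) (V t)) atTop (𝓝 0) := by
        have hb : Tendsto (fun t => ‖X t‖ * (2 * (‖x₀‖ + ‖X t‖))) atTop (𝓝 0) := by
          simpa using hlim.mul ((hlim.const_add ‖x₀‖).const_mul 2)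
        refine squeeze_zero_norm' ?_ hb
        filter_upwards [eventually_ge_atTop 0] with t ht
        rw [norm_mul, Real.norm_of_nonneg ht]
        have h2 := norm_inner_le_norm (𝕜 := ℝ) (X t) (V t)
        have h3 := hX.mul_norm_velocity_le hε ha.le ht
        have h4 := mul_le_mul_of_nonneg_left h3 (norm_nonneg (X t))
        have h5 := mul_le_mul_of_nonneg_left h2 ht
        nlinarith
      simpa using h1.add (hlim.pow 2)
    -- The comparison function is the virial quantity plus `c log log t`: its derivative is at most
    -- `t ‖V‖²` because `f ≤ ⟨∇f, X⟩`.
    refine lintegral_eq_top_of_tendsto_atTop hT0 ?_ ?_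
      (fun t ht => (hX.hasDerivAt_virial (by linarith)).add (hWd t ht)) ?_
      (hvir.add_atTop hW)
    · exact continuousOn_id.mul ((hX.continuousOn_velocity.mono hsub).norm.pow 2)
    · intro t ht
      have := hT0.trans ht
      positivity
    · intro t ht
      have h1 := (hT t ht).1
      have h2 := mul_le_mul_of_nonneg_left (potential_le_inner hε ha.le (X t)) (hT0.trans ht)
      linarith

end IsSolution

/-! ### Positivity of the created momentum for small `ε`. -/

lemma exists_first_hitting {u : ℝ → ℝ} (hc : ContinuousOn u (Ici 0)) {δ : ℝ} (h0 : δ < u 0)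
    (hex : ∃ t, 0 ≤ t ∧ u t ≤ δ) : ∃ s, 0 < s ∧ u s = δ ∧ ∀ t, 0 ≤ t → u t ≤ δ → s ≤ t := by
  set S := {t : ℝ | t ∈ Ici 0 ∧ u t ∈ Iic δ} with hS
  have hcl : IsClosed S := hc.preimage_isClosed_of_isClosed isClosed_Ici isClosed_Iic
  have hbd : BddBelow S := ⟨0, fun t ht => ht.1⟩
  have hmem : sInf S ∈ S := hcl.csInf_mem hex hbd
  obtain ⟨s, hs, hus⟩ := intermediate_value_Icc' (show (0 : ℝ) ≤ sInf S from hmem.1)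
    (hc.mono Icc_subset_Ici_self) (show δ ∈ Icc (u (sInf S)) (u 0) from ⟨hmem.2, h0.le⟩)
  refine ⟨s, hs.1.lt_of_ne' ?_, hus, fun t ht hut => hs.2.trans (csInf_le hbd ⟨ht, hut⟩)⟩
  rintro rfl
  exact h0.ne' hus

lemma norm_start {a : ℝ} (ha : 0 ≤ a) : ‖(!₂[2 * a, a] : Plane)‖ = √5 * a := by
  rw [EuclideanSpace.norm_eq, Fin.sum_univ_two]
  simp only [Matrix.cons_val_zero, Matrix.cons_val_one, Real.norm_eq_abs, sq_abs]
  rw [show (2 * a) ^ 2 + a ^ 2 = 5 * a ^ 2 by ring, Real.sqrt_mul (by norm_num),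
    Real.sqrt_sq ha]

lemma norm_start_sq (a : ℝ) : ‖(!₂[2 * a, a] : Plane)‖ ^ 2 = 5 * a ^ 2 := by
  rw [EuclideanSpace.norm_sq_eq, Fin.sum_univ_two]
  simp only [Matrix.cons_val_zero, Matrix.cons_val_one, Real.norm_eq_abs, sq_abs]
  ring

lemma plane_norm_sq (x : Plane) : ‖x‖ ^ 2 = x 0 ^ 2 + x 1 ^ 2 := by
  simp [EuclideanSpace.norm_sq_eq, Fin.sum_univ_two]

lemma force_apply_zero (ψ : ℝ → ℝ) (x : Plane) :
    force ψ x 0 = slope ‖x‖ / ‖x‖ * x 0 + ψ (x 0) := by simp [force]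

lemma force_apply_one (ψ : ℝ → ℝ) (x : Plane) : force ψ x 1 = slope ‖x‖ / ‖x‖ * x 1 := by
  simp [force]

lemma push_nonneg {ε : ℝ} (hε : 0 ≤ ε) (a u : ℝ) : 0 ≤ push ε a u :=
  mul_nonneg hε (le_max_right _ _)

namespace IsSolution

variable {ε a s : ℝ} {x₀ : Plane} {X V : ℝ → Plane}

lemma momentum_monotoneOn (hX : IsSolution (force (push ε a)) x₀ X V) (hε : 0 ≤ ε)
    (h1 : ∀ t ∈ Icc 0 s, 0 ≤ X t 1) : MonotoneOn (momentum X V) (Icc 0 s) := by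
  refine monotoneOn_of_hasDerivAt_nonneg (convex_Icc 0 s)
    (hX.continuousOn_momentum.mono Icc_subset_Ici_self)
    (fun t ht => hX.hasDerivAt_momentum (by rw [interior_Icc] at ht; exact ht.1))
    fun t ht => ?_
  rw [interior_Icc] at ht
  have := ht.1
  exact mul_nonneg (by positivity)
    (mul_nonneg (h1 t ⟨ht.1.le, ht.2.le⟩) (push_nonneg hε a _))

lemma momentum_nonneg (hX : IsSolution (force (push ε a)) x₀ X V) (hε : 0 ≤ ε)
    (h1 : ∀ t ∈ Icc 0 s, 0 ≤ X t 1) {t : ℝ} (ht : t ∈ Icc 0 s) : 0 ≤ momentum X V t := by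
  rw [← momentum_zero X V]
  exact hX.momentum_monotoneOn hε h1 ⟨le_rfl, ht.1.trans ht.2⟩ ht ht.1

/-- Links angle and torque: nonnegative momentum makes the path rotate only counterclockwise, and
small momentum makes it rotate little. -/
lemma hasDerivAt_ratio (hX : IsSolution (force (push ε a)) x₀ X V) {t : ℝ} (ht : 0 < t)
    (h0 : X t 0 ≠ 0) : HasDerivAt (fun t => X t 1 / X t 0)
      (momentum X V t / (t ^ 3 * X t 0 ^ 2)) t := by
  refine ((hasDerivAt_coord (hX.hasDerivAt_position t ht) 1).div
    (hasDerivAt_coord (hX.hasDerivAt_position t ht) 0) h0).congr_deriv ?_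
  rw [momentum]
  field_simp

lemma continuousOn_ratio (hX : IsSolution (force (push ε a)) x₀ X V)
    (h0 : ∀ t ∈ Icc 0 s, 0 < X t 0) : ContinuousOn (fun t => X t 1 / X t 0) (Icc 0 s) :=
  ((continuousOn_coord hX.continuousOn_position 1).mono Icc_subset_Ici_self).div
    ((continuousOn_coord hX.continuousOn_position 0).mono Icc_subset_Ici_self)
    fun t ht => (h0 t ht).ne'

lemma ratio_monotoneOn (hX : IsSolution (force (push ε a)) x₀ X V) (hε : 0 ≤ ε)
    (h0 : ∀ t ∈ Icc 0 s, 0 < X t 0) (h1 : ∀ t ∈ Icc 0 s, 0 ≤ X t 1) :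
    MonotoneOn (fun t => X t 1 / X t 0) (Icc 0 s) := by
  have hsub : interior (Icc 0 s) ⊆ Icc 0 s := interior_subset
  refine monotoneOn_of_hasDerivAt_nonneg (convex_Icc 0 s) (hX.continuousOn_ratio h0)
    (fun t ht => hX.hasDerivAt_ratio (by rw [interior_Icc] at ht; exact ht.1)
      (h0 t (hsub ht)).ne') fun t ht => ?_
  have h := hX.momentum_nonneg hε h1 (hsub ht)
  have := (hsub ht).1
  positivity

/-- A continuation argument: the ratio of the coordinates starts at `1 / 2` and increases while the
second coordinate is nonnegative, so that coordinate cannot reach a first zero. -/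
lemma half_le_coord_one (hX : IsSolution (force (push ε a)) !₂[2 * a, a] X V) (hε : 0 ≤ ε)
    (ha : 0 < a) (h0 : ∀ t ∈ Icc 0 s, 0 < X t 0) {t : ℝ} (ht : t ∈ Icc 0 s) :
    X t 0 / 2 ≤ X t 1 := by
  have hz0 : X 0 1 / X 0 0 = 1 / 2 := by
    rw [hX.initial_position]; simp; field_simp
  have hpos : ∀ t ∈ Icc 0 s, 0 ≤ X t 1 := by
    by_contra! hcon
    obtain ⟨t, ht, hneg⟩ := hcon
    obtain ⟨q, hq, hXq, hfirst⟩ := exists_first_hitting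
      (continuousOn_coord hX.continuousOn_position 1) (δ := 0)
      (by rw [hX.initial_position]; simpa using ha) ⟨t, ht.1, hneg.le⟩
    have hqs : q ≤ s := (hfirst t ht.1 hneg.le).trans ht.2
    have hmono := hX.ratio_monotoneOn hε (s := q) (fun r hr => h0 r ⟨hr.1, hr.2.trans hqs⟩)
      fun r hr => by
        by_contra! hlt
        have := hfirst r hr.1 hlt.le
        rw [le_antisymm hr.2 this, hXq] at hlt
        exact lt_irrefl _ hlt
    have := hmono ⟨le_rfl, hq.le⟩ ⟨hq.le, le_rfl⟩ hq.le
    simp only [hz0, hXq, zero_div] at this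
    norm_num at this
  have := hX.ratio_monotoneOn hε h0 hpos ⟨le_rfl, ht.1.trans ht.2⟩ ht ht.1
  simp only [hz0] at this
  rw [le_div_iff₀ (h0 t ht)] at this
  linarith

lemma hasDerivAt_weighted_velocity {G : Plane → Plane} (hX : IsSolution G x₀ X V) (i : Fin 2)
    {t : ℝ} (ht : 0 < t) : HasDerivAt (fun t => t ^ 3 * V t i) (-(t ^ 3 * G (X t) i)) t := by
  refine ((hasDerivAt_pow 3 t).mul
    (hasDerivAt_coord (hX.hasDerivAt_velocity t ht) i)).congr_deriv ?_
  simp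
  field_simp
  ring

lemma velocity_nonpos {G : Plane → Plane} (hX : IsSolution G x₀ X V) (i : Fin 2)
    (hG : ∀ t ∈ Icc 0 s, 0 ≤ G (X t) i) {t : ℝ} (ht : t ∈ Icc 0 s) : V t i ≤ 0 := by
  rcases ht.1.eq_or_lt with h | h
  · rw [← h, hX.initial_velocity]; simp
  have hanti : AntitoneOn (fun t => t ^ 3 * V t i) (Icc 0 s) := by
    refine antitoneOn_of_hasDerivAt_nonpos (convex_Icc 0 s)
      ((continuousOn_pow 3).mul
        ((continuousOn_coord hX.continuousOn_velocity i).mono Icc_subset_Ici_self))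
      (fun t ht => hX.hasDerivAt_weighted_velocity i (by rw [interior_Icc] at ht; exact ht.1))
      fun t ht => ?_
    rw [interior_Icc] at ht
    have := hG t ⟨ht.1.le, ht.2.le⟩
    have := ht.1
    have : 0 ≤ t ^ 3 * G (X t) i := by positivity
    linarith
  have h2 := hanti ⟨le_rfl, ht.1.trans ht.2⟩ ht ht.1
  simp only [ne_eq, OfNat.ofNat_ne_zero, not_false_eq_true, zero_pow, zero_mul] at h2
  by_contra! hcon
  have : 0 < t ^ 3 * V t i := by positivity
  linarith

lemma coord_antitoneOn {G : Plane → Plane} (hX : IsSolution G x₀ X V) (i : Fin 2)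
    (hG : ∀ t ∈ Icc 0 s, 0 ≤ G (X t) i) : AntitoneOn (fun t => X t i) (Icc 0 s) :=
  antitoneOn_of_hasDerivAt_nonpos (convex_Icc 0 s)
    ((continuousOn_coord hX.continuousOn_position i).mono Icc_subset_Ici_self)
    (fun t ht => hasDerivAt_coord
      (hX.hasDerivAt_position t (by rw [interior_Icc] at ht; exact ht.1)) i)
    fun _ ht => hX.velocity_nonpos i hG (interior_subset ht)

/-- Up to time `s` the first coordinate is at least `δ`, and the second one at least half of it. -/
structure IsFirstPhase (X : ℝ → Plane) (δ s : ℝ) : Prop where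
  pos : 0 < δ
  le_coord : ∀ t ∈ Icc 0 s, δ ≤ X t 0
  half_le : ∀ t ∈ Icc 0 s, X t 0 / 2 ≤ X t 1

section FirstPhase

variable {δ : ℝ}

lemma IsFirstPhase.force_nonneg (h : IsFirstPhase X δ s) (hε : 0 ≤ ε) {t : ℝ} (ht : t ∈ Icc 0 s) :
    0 ≤ force (push ε a) (X t) 0 ∧ 0 ≤ force (push ε a) (X t) 1 := by
  have h0 : 0 ≤ X t 0 := h.pos.le.trans (h.le_coord t ht)
  have h1 : 0 ≤ X t 1 := by linarith [h.half_le t ht]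
  have h2 : 0 ≤ slope ‖X t‖ / ‖X t‖ := div_nonneg (slope_nonneg _) (norm_nonneg _)
  rw [force_apply_zero, force_apply_one]
  exact ⟨add_nonneg (mul_nonneg h2 h0) (push_nonneg hε a _), mul_nonneg h2 h1⟩

lemma IsFirstPhase.coord_le (h : IsFirstPhase X δ s)
    (hX : IsSolution (force (push ε a)) !₂[2 * a, a] X V) (hε : 0 ≤ ε) {t : ℝ}
    (ht : t ∈ Icc 0 s) : X t 0 ≤ 2 * a ∧ X t 1 ≤ a := by
  have h0 := hX.coord_antitoneOn 0 (fun t ht => (h.force_nonneg hε ht).1)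
    ⟨le_rfl, ht.1.trans ht.2⟩ ht ht.1
  have h1 := hX.coord_antitoneOn 1 (fun t ht => (h.force_nonneg hε ht).2)
    ⟨le_rfl, ht.1.trans ht.2⟩ ht ht.1
  simp only [hX.initial_position] at h0 h1
  exact ⟨by simpa using h0, by simpa using h1⟩

/-- Both coordinates decrease from `(2a, a)`, so the torque is at most `ε a² t³`. -/
lemma IsFirstPhase.momentum_le (h : IsFirstPhase X δ s)
    (hX : IsSolution (force (push ε a)) !₂[2 * a, a] X V) (hε : 0 ≤ ε) (ha : 0 < a) {t : ℝ}
    (ht : t ∈ Icc 0 s) : momentum X V t ≤ ε * a ^ 2 * t ^ 4 / 4 := by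
  have hanti : AntitoneOn (fun t => momentum X V t - ε * a ^ 2 * t ^ 4 / 4) (Icc 0 s) := by
    refine antitoneOn_of_hasDerivAt_nonpos (convex_Icc 0 s)
      ((hX.continuousOn_momentum.mono Icc_subset_Ici_self).sub (by fun_prop))
      (fun t ht => (hX.hasDerivAt_momentum (by rw [interior_Icc] at ht; exact ht.1)).sub
        (((hasDerivAt_pow 4 t).const_mul (ε * a ^ 2)).div_const 4)) fun t ht => ?_
    have ht := interior_subset ht
    obtain ⟨h0, h1⟩ := h.coord_le hX hε ht
    have h2 : push ε a (X t 0) ≤ ε * a :=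
      mul_le_mul_of_nonneg_left (max_le (by linarith) ha.le) hε
    have h3 : X t 1 * push ε a (X t 0) ≤ a * (ε * a) :=
      mul_le_mul h1 h2 (push_nonneg hε a _) ha.le
    have h4 := mul_le_mul_of_nonneg_left h3 (pow_nonneg ht.1 3)
    push_cast
    nlinarith
  have := hanti ⟨le_rfl, ht.1.trans ht.2⟩ ht ht.1
  simp only [momentum_zero] at this
  norm_num at this
  linarith

lemma IsFirstPhase.ratio_le (h : IsFirstPhase X δ s)
    (hX : IsSolution (force (push ε a)) !₂[2 * a, a] X V) (hε : 0 ≤ ε) (ha : 0 < a) {t : ℝ}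
    (ht : t ∈ Icc 0 s) : X t 1 / X t 0 ≤ 1 / 2 + ε * a ^ 2 * t ^ 2 / (8 * δ ^ 2) := by
  have hδ := h.pos
  have h0 : ∀ t ∈ Icc 0 s, 0 < X t 0 := fun t ht => hδ.trans_le (h.le_coord t ht)
  have hanti : AntitoneOn (fun t => X t 1 / X t 0 - ε * a ^ 2 * t ^ 2 / (8 * δ ^ 2))
      (Icc 0 s) := by
    refine antitoneOn_of_hasDerivAt_nonpos (convex_Icc 0 s)
      ((hX.continuousOn_ratio h0).sub (by fun_prop))
      (fun t ht => (hX.hasDerivAt_ratio (by rw [interior_Icc] at ht; exact ht.1)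
        (h0 t (interior_subset ht)).ne').sub
        (((hasDerivAt_pow 2 t).const_mul (ε * a ^ 2)).div_const (8 * δ ^ 2))) fun t ht => ?_
    have htpos : 0 < t := by rw [interior_Icc] at ht; exact ht.1
    have ht := interior_subset ht
    have h1 := h.momentum_le hX hε ha ht
    have h2 : momentum X V t / (t ^ 3 * X t 0 ^ 2)
        ≤ (ε * a ^ 2 * t ^ 4 / 4) / (t ^ 3 * δ ^ 2) := by
      refine div_le_div₀ (by positivity) h1 (by positivity) ?_
      exact mul_le_mul_of_nonneg_left (pow_le_pow_left₀ hδ.le (h.le_coord t ht) 2)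
        (by positivity)
    refine sub_nonpos.2 (h2.trans (le_of_eq ?_))
    push_cast
    field_simp
    ring
  have := hanti ⟨le_rfl, ht.1.trans ht.2⟩ ht ht.1
  simp only [hX.initial_position] at this
  norm_num at this
  have h3 : a / (2 * a) = 1 / 2 := by field_simp
  rw [h3] at this
  linarith

/-- The potential is at least `profile δ` during the phase, so the Lyapunov bound with `‖x₀‖² = 5
a²` limits its duration by `t² profile δ ≤ 10 a²`. The smallness hypothesis then keeps the drift
below `1 / 10`, and `3 / 5 = 1 / 2 + 1 / 10`. -/
lemma IsFirstPhase.ratio_le_of_small (h : IsFirstPhase X δ s)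
    (hX : IsSolution (force (push ε a)) !₂[2 * a, a] X V) (hε : 0 ≤ ε) (ha : 0 < a)
    (hsmall : 100 * ε * a ^ 4 ≤ 8 * δ ^ 2 * profile δ) {t : ℝ}
    (ht : t ∈ Icc 0 s) : X t 1 ≤ 3 / 5 * X t 0 := by
  have hδ := h.pos
  have hpδ := profile_pos hδ
  have h0 : 0 < X t 0 := hδ.trans_le (h.le_coord t ht)
  have h1 := h.ratio_le hX hε ha ht
  have h2 := hX.lyapunov_le (hasGradientAt_potential ε a) (potential_le_inner hε ha.le) ht.1
  rw [norm_start_sq] at h2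
  have h3 : profile δ ≤ potential ε a (X t) :=
    (profile_monotone ((h.le_coord t ht).trans (coord_le_norm (X t) 0))).trans
      (profile_norm_le_potential hε a _)
  have h4 : t ^ 2 * profile δ ≤ 10 * a ^ 2 := by
    have := mul_le_mul_of_nonneg_left h3 (sq_nonneg t)
    nlinarith [sq_nonneg ‖X t + (t / 2) • V t‖]
  have h5 : ε * a ^ 2 * t ^ 2 / (8 * δ ^ 2) ≤ 1 / 10 := by
    rw [div_le_iff₀ (by positivity)]
    have h6 := mul_le_mul_of_nonneg_left h4 (show 0 ≤ ε * a ^ 2 by positivity)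
    have h7 : (ε * a ^ 2 * t ^ 2) * profile δ ≤ (1 / 10 * (8 * δ ^ 2)) * profile δ := by
      nlinarith
    exact le_of_mul_le_mul_right h7 hpδ
  rw [← div_le_iff₀ h0]
  linarith

/-- The component of `x` along the direction of the starting point `(2a, a)`. -/
def along (x : Plane) : ℝ := (2 * x 0 + x 1) / √5

lemma along_sq_le (x : Plane) : along x ^ 2 ≤ ‖x‖ ^ 2 := by
  rw [along, div_pow, Real.sq_sqrt (by norm_num), plane_norm_sq, div_le_iff₀ (by norm_num)]
  nlinarith [sq_nonneg (x 0 - 2 * x 1)]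

lemma along_le_norm (x : Plane) : along x ≤ ‖x‖ :=
  (abs_le_of_sq_le_sq' (along_sq_le x) (norm_nonneg x)).2

/-- Directions of slope between `1 / 2` and `3 / 5` nearly align with `(2, 1)`: the cosine is above
`0.99`, so `0.98` has room to spare. -/
lemma norm_le_along {x : Plane} (h0 : 0 ≤ x 0) (h1 : x 0 / 2 ≤ x 1) (h2 : x 1 ≤ 3 / 5 * x 0) :
    0.98 * ‖x‖ ≤ along x := by
  have hnn : 0 ≤ along x := div_nonneg (by linarith) (Real.sqrt_nonneg _)
  refine abs_le_of_sq_le_sq' ?_ hnn |>.2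
  rw [along, mul_pow, div_pow, Real.sq_sqrt (by norm_num), plane_norm_sq,
    le_div_iff₀ (by norm_num)]
  nlinarith [mul_nonneg (sub_nonneg.2 h1) (sub_nonneg.2 h2), mul_nonneg h0 (sub_nonneg.2 h1),
    mul_nonneg h0 (sub_nonneg.2 h2), mul_nonneg h0 h0]

lemma hasDerivAt_along {Y : ℝ → Plane} {v : Plane} {t : ℝ} (h : HasDerivAt Y v t) :
    HasDerivAt (fun t => along (Y t)) (along v) t :=
  (((hasDerivAt_coord h 0).const_mul 2).add (hasDerivAt_coord h 1)).div_const _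

lemma continuousOn_along {Y : ℝ → Plane} {S : Set ℝ} (h : ContinuousOn Y S) :
    ContinuousOn (fun t => along (Y t)) S :=
  ((continuousOn_const.mul (continuousOn_coord h 0)).add (continuousOn_coord h 1)).div_const _

/-- The component of `X` along the starting ray decreases, so at earlier times the inward force was
at least `0.98` times the current slope. Integrating against `q ^ 3` produces the factor `t / 4`. -/
lemma IsFirstPhase.along_velocity_le (h : IsFirstPhase X δ s)
    (hX : IsSolution (force (push ε a)) !₂[2 * a, a] X V) (hε : 0 ≤ ε)
    (hratio : ∀ t ∈ Icc 0 s, X t 1 ≤ 3 / 5 * X t 0) {t : ℝ} (ht : t ∈ Icc 0 s) :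
    along (V t) ≤ -(0.98 * (t / 4) * slope (along (X t))) := by
  rcases ht.1.eq_or_lt with h0 | htpos
  · rw [← h0, hX.initial_velocity]; simp [along]
  have hsub : ∀ {q}, q ∈ Icc 0 t → q ∈ Icc 0 s := fun hq => ⟨hq.1, hq.2.trans ht.2⟩
  set c := slope (along (X t)) with hc
  have h5 : 0 < √(5 : ℝ) := Real.sqrt_pos.2 (by norm_num)
  have hanti : AntitoneOn (fun q => q ^ 3 * along (V q) + 0.98 * c * q ^ 4 / 4) (Icc 0 t) := by
    refine antitoneOn_of_hasDerivAt_nonpos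
      (f' := fun q => -(q ^ 3 * along (force (push ε a) (X q))) + 0.98 * c * q ^ 3)
      (convex_Icc 0 t)
      (((continuousOn_pow 3).mul (continuousOn_along
        (hX.continuousOn_velocity.mono Icc_subset_Ici_self))).add (by fun_prop)) ?_ ?_
    · intro q hq
      rw [interior_Icc] at hq
      have hw := fun i => hX.hasDerivAt_weighted_velocity i hq.1
      refine (HasDerivAt.add (f := fun q => q ^ 3 * along (V q)) (?_ : HasDerivAt _
        (-(q ^ 3 * along (force (push ε a) (X q)))) q)
        (((hasDerivAt_pow 4 q).const_mul (0.98 * c)).div_const 4)).congr_deriv ?_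
      · refine (((((hw 0).const_mul 2).add (hw 1)).div_const √5).congr_deriv ?_).congr_of_eventuallyEq
          (Eventually.of_forall fun r => ?_)
        · rw [along]; ring
        · simp only [along, Pi.add_apply]; ring
      · push_cast; ring
    · intro q hq
      have hq' := interior_subset hq
      have hqs := hsub hq'
      have hx0 : 0 < X q 0 := h.pos.trans_le (h.le_coord q hqs)
      have hn : 0 < ‖X q‖ := hx0.trans_le (coord_le_norm _ _)
      have hal := norm_le_along hx0.le (h.half_le q hqs) (hratio q hqs)
      have hmono : along (X t) ≤ along (X q) := by
        have a0 := hX.coord_antitoneOn 0 (fun t ht => (h.force_nonneg hε ht).1) hqs ht hq'.2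
        have a1 := hX.coord_antitoneOn 1 (fun t ht => (h.force_nonneg hε ht).2) hqs ht hq'.2
        simp only at a0 a1
        exact div_le_div_of_nonneg_right (by linarith) h5.le
      have hsl : c ≤ slope ‖X q‖ := slope_monotone (hmono.trans (along_le_norm _))
      have hG : 0.98 * c ≤ along (force (push ε a) (X q)) := by
        have e : along (force (push ε a) (X q))
            = slope ‖X q‖ / ‖X q‖ * along (X q) + 2 * push ε a (X q 0) / √5 := by
          rw [along, along, force_apply_zero, force_apply_one]; ring
        have hp : 0 ≤ 2 * push ε a (X q 0) / √5 := by
          have := push_nonneg hε a (X q 0); positivity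
        have h6 := mul_le_mul_of_nonneg_left hal
          (div_nonneg (slope_nonneg ‖X q‖) (norm_nonneg (X q)))
        have h7 : slope ‖X q‖ / ‖X q‖ * (0.98 * ‖X q‖) = 0.98 * slope ‖X q‖ := by field_simp
        rw [e]
        linarith
      have := mul_le_mul_of_nonneg_left hG (pow_nonneg hq'.1 3)
      linarith
  have h1 := hanti ⟨le_rfl, ht.1⟩ ⟨ht.1, le_rfl⟩ ht.1
  norm_num at h1
  have h2 : t ^ 3 * (along (V t) + 0.98 * (t / 4) * c) ≤ 0 := by linarith
  have h3 := nonpos_of_mul_nonpos_right h2 (by positivity : 0 < t ^ 3)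
  linarith

/-- In the dissipation `(3 / t) ‖V‖²`, one factor of the speed is bounded below by `0.98 (t / 4)`
times the slope. What remains is `0.735 = 3 · 0.98 / 4` times the loss rate of `profile (along X)`.
-/
lemma IsFirstPhase.energy_antitoneOn (h : IsFirstPhase X δ s)
    (hX : IsSolution (force (push ε a)) !₂[2 * a, a] X V) (hε : 0 ≤ ε)
    (hratio : ∀ t ∈ Icc 0 s, X t 1 ≤ 3 / 5 * X t 0) :
    AntitoneOn (fun t => (1 / 2 * ‖V t‖ ^ 2 + potential ε a (X t))
      - 0.735 * profile (along (X t))) (Icc 0 s) := by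
  refine antitoneOn_of_hasDerivAt_nonpos (convex_Icc 0 s)
    (((hX.continuousOn_energy (hasGradientAt_potential ε a)).mono Icc_subset_Ici_self).sub
      (continuousOn_const.mul (profile_continuous.comp_continuousOn
        (continuousOn_along (hX.continuousOn_position.mono Icc_subset_Ici_self)))))
    (fun t ht => (hX.hasDerivAt_energy (hasGradientAt_potential ε a)
      (by rw [interior_Icc] at ht; exact ht.1)).sub
      (((profile_hasDerivAt _).comp t (hasDerivAt_along (hX.hasDerivAt_position t
        (by rw [interior_Icc] at ht; exact ht.1)))).const_mul 0.735)) fun t ht => ?_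
  have htpos : 0 < t := by rw [interior_Icc] at ht; exact ht.1
  have h1 := h.along_velocity_le hX hε hratio (interior_subset ht)
  have h2 := along_sq_le (V t)
  set w := along (V t)
  set c := slope (along (X t))
  have hc : 0 ≤ c := slope_nonneg _
  have hw : w ≤ 0 := by
    have : 0 ≤ 0.98 * (t / 4) * c := by positivity
    linarith
  have h3 : (0.98 * (t / 4) * c) * (-w) ≤ w ^ 2 := by nlinarith
  have h4 : 3 / t * ((0.98 * (t / 4) * c) * (-w)) ≤ 3 / t * ‖V t‖ ^ 2 :=
    mul_le_mul_of_nonneg_left (h3.trans h2) (by positivity)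
  have h5 : 3 / t * ((0.98 * (t / 4) * c) * (-w)) = 0.735 * (c * (-w)) := by
    field_simp; ring
  linarith

end FirstPhase

/-- Before the first coordinate reaches `δ` the second is positive; afterwards too little energy is
left to exit the disc of radius `a`, so the second factor vanishes. -/
lemma coord_one_mul_push_nonneg (hX : IsSolution (force (push ε a)) !₂[2 * a, a] X V)
    (hε : 0 ≤ ε) (ha : 0 < a) {δ : ℝ} (hδ : 0 < δ) (hδa : δ < a)
    (h2δ : profile (2 * δ) ≤ profile a / 100) (hεa : ε * a ^ 2 ≤ profile a / 100)
    (hsmall : 100 * ε * a ^ 4 ≤ 8 * δ ^ 2 * profile δ) {t : ℝ} (ht : 0 ≤ t) :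
    0 ≤ X t 1 * max (X t 0 - a) 0 := by
  have hlim := hX.tendsto_zero hε ha.le
  obtain ⟨s, hs, hXs, hfirst⟩ := exists_first_hitting
    (continuousOn_coord hX.continuousOn_position 0) (δ := δ)
    (by rw [hX.initial_position]; simp; linarith) (by
      obtain ⟨q, hq, hqδ⟩ := ((eventually_ge_atTop (0 : ℝ)).and
        ((tendsto_zero_iff_norm_tendsto_zero.1 hlim).eventually (gt_mem_nhds hδ))).exists
      exact ⟨q, hq, (coord_le_norm _ _).trans hqδ.le⟩)
  have hlow : ∀ t ∈ Icc 0 s, δ ≤ X t 0 := by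
    intro q hq
    by_contra! hlt
    rw [le_antisymm hq.2 (hfirst q hq.1 hlt.le), hXs] at hlt
    exact lt_irrefl _ hlt
  have hph : IsFirstPhase X δ s := ⟨hδ, hlow, fun t ht =>
    hX.half_le_coord_one hε ha (fun t ht => hδ.trans_le (hlow t ht)) ht⟩
  rcases le_total t s with hts | hts
  · have h0 := hlow t ⟨ht, hts⟩
    have h1 := hph.half_le t ⟨ht, hts⟩
    exact mul_nonneg (by linarith) (le_max_right _ _)
  have hratio : ∀ t ∈ Icc 0 s, X t 1 ≤ 3 / 5 * X t 0 :=
    fun t ht => hph.ratio_le_of_small hX hε ha hsmall ht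
  have h1 := hph.energy_antitoneOn hX hε hratio ⟨le_rfl, hs.le⟩ ⟨hs.le, le_rfl⟩ hs.le
  have h2 := hX.energy_antitoneOn (hasGradientAt_potential ε a) (mem_Ici.2 hs.le)
    (mem_Ici.2 ht) hts
  have h5 : 0 < √(5 : ℝ) := Real.sqrt_pos.2 (by norm_num)
  have h5s : √(5 : ℝ) ^ 2 = 5 := Real.sq_sqrt (by norm_num)
  have hal0 : along (!₂[2 * a, a] : Plane) = √5 * a := by
    simp only [along, Matrix.cons_val_zero, Matrix.cons_val_one]
    rw [div_eq_iff h5.ne']; nlinarith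
  -- At time `s` the value is at most `2.6 δ / √5`.
  have hals : along (X s) ≤ 2 * δ := by
    have := hratio s ⟨hs.le, le_rfl⟩
    rw [hXs] at this
    rw [along, hXs, div_le_iff₀ h5]
    nlinarith
  have hpot0 : potential ε a !₂[2 * a, a] = profile (√5 * a) + ε * a ^ 2 / 2 := by
    rw [potential_eq, generalPotential, norm_start ha.le]
    simp only [oneSidedQuadratic, Matrix.cons_val_zero]
    rw [show 2 * a - a = a by ring, max_eq_left ha.le]
    ring
  simp only [hX.initial_position, hX.initial_velocity, hal0, hpot0, norm_zero] at h1
  have h6 := profile_sqrt_five_mul_le ha.le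
  have h7 := (profile_monotone hals).trans h2δ
  have h8 := profile_norm_le_potential hε a (X t)
  have h9 := profile_pos ha
  -- The remaining energy is at most `0.265 · 3.62 + 0.005 + 0.00735 < 1` times `profile a`.
  have h10 : profile ‖X t‖ < profile a := by
    simp only at h2
    nlinarith [sq_nonneg ‖V t‖]
  have h11 : ‖X t‖ < a := by
    by_contra! hcon
    exact not_lt.2 (profile_monotone hcon) h10
  rw [max_eq_right (by linarith [coord_le_norm (X t) 0]), mul_zero]

lemma radialTime_pos (hX : IsSolution (force (push ε a)) !₂[2 * a, a] X V) (hε : 0 ≤ ε)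
    (ha : 0 < a) : 0 < radialTime a X := by
  have hn : a < ‖X 0‖ := by
    rw [hX.initial_position]
    refine lt_of_lt_of_le ?_ (coord_le_norm _ 0)
    simp; linarith
  have hc : Tendsto (fun t => ‖X t‖) (𝓝[Ici 0] 0) (𝓝 ‖X 0‖) :=
    (hX.continuousOn_position 0 (mem_Ici.2 le_rfl)).norm
  have hev := (hc.eventually (lt_mem_nhds hn)).filter_mono
    (nhdsWithin_mono 0 (Ioi_subset_Ici_self))
  obtain ⟨t, ht, ht0⟩ := (hev.and self_mem_nhdsWithin).exists
  exact (show (0 : ℝ) < t from ht0).trans_le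
    (le_csSup (bddAbove_radial (hX.tendsto_zero hε ha.le) ha) ⟨le_of_lt ht0, ht⟩)

lemma createdMomentum_pos (hX : IsSolution (force (push ε a)) !₂[2 * a, a] X V)
    (hε : 0 < ε) (ha : 0 < a) (h : ∀ t, 0 ≤ t → 0 ≤ X t 1 * max (X t 0 - a) 0) :
    0 < createdMomentum ε a X := by
  have hT := hX.radialTime_pos hε.le ha
  refine mul_pos hε (intervalIntegral.integral_pos hT
    (hX.continuousOn_momentumRate.mono Icc_subset_Ici_self) (fun t ht => ?_) ?_)
  · rw [mul_assoc]
    exact mul_nonneg (pow_nonneg ht.1.le 3) (h t ht.1.le)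
  · have hc := fun i => (continuousOn_coord hX.continuousOn_position i) 0 (mem_Ici.2 le_rfl)
    have e0 : ∀ᶠ t in 𝓝[Ici 0] (0 : ℝ), a < X t 0 :=
      (hc 0).eventually (lt_mem_nhds (by simp [hX.initial_position]; linarith))
    have e1 : ∀ᶠ t in 𝓝[Ici 0] (0 : ℝ), 0 < X t 1 :=
      (hc 1).eventually (lt_mem_nhds (by simpa [hX.initial_position] using ha))
    have hev := (e0.and e1).filter_mono (nhdsWithin_mono 0 (Ioi_subset_Ici_self))
    have hlt : ∀ᶠ t in 𝓝[>] (0 : ℝ), t < radialTime a X :=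
      (gt_mem_nhds hT : ∀ᶠ t in 𝓝 (0 : ℝ), t < radialTime a X).filter_mono nhdsWithin_le_nhds
    obtain ⟨t, ⟨⟨h0, h1⟩, ht⟩, htpos⟩ := ((hev.and hlt).and self_mem_nhdsWithin).exists
    have htpos : 0 < t := htpos
    refine ⟨t, ⟨htpos.le, ht.le⟩, ?_⟩
    rw [max_eq_left (by linarith)]
    have : 0 < X t 0 - a := by linarith
    positivity

end IsSolution

lemma exists_small_perturbation {a : ℝ} (ha : 0 < a) :
    ∃ ε₀ : ℝ, 0 < ε₀ ∧ ∀ ε, 0 < ε → ε < ε₀ → ∀ X V : ℝ → Plane,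
      IsSolution (force (push ε a)) !₂[2 * a, a] X V → 0 < createdMomentum ε a X := by
  have hpa := profile_pos ha
  obtain ⟨δ, hδ, hδa, h2δ⟩ : ∃ δ, 0 < δ ∧ δ < a ∧ profile (2 * δ) ≤ profile a / 100 := by
    have hc : Tendsto (fun δ => profile (2 * δ)) (𝓝 0) (𝓝 0) := by
      have : Continuous fun δ => profile (2 * δ) := profile_continuous.comp (by fun_prop)
      simpa [profile_zero] using this.tendsto 0
    have hev : ∀ᶠ δ in 𝓝 (0 : ℝ), profile (2 * δ) < profile a / 100 ∧ δ < a :=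
      (hc.eventually (gt_mem_nhds (by positivity))).and (gt_mem_nhds ha)
    obtain ⟨δ, ⟨h1, h2⟩, h3⟩ := ((hev.filter_mono (nhdsWithin_le_nhds (s := Ioi 0))).and
      self_mem_nhdsWithin).exists
    exact ⟨δ, h3, h2, h1.le⟩
  have hpδ := profile_pos hδ
  -- The first bound makes the initial energy of the push negligible, the second keeps the rotation
  -- small.
  refine ⟨min (profile a / 100 / a ^ 2) (8 * δ ^ 2 * profile δ / (100 * a ^ 4)),
    lt_min (by positivity) (by positivity), fun ε hε hlt X V hX => ?_⟩
  have h1 := (lt_div_iff₀ (by positivity)).1 (hlt.trans_le (min_le_left _ _))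
  have h2 := (lt_div_iff₀ (by positivity)).1 (hlt.trans_le (min_le_right _ _))
  exact hX.createdMomentum_pos hε ha fun t ht =>
    hX.coord_one_mul_push_nonneg hε.le ha hδ hδa h2δ h1.le (by linarith) ht

/-! ### Existence for a bounded continuous force. -/

section Existence

variable {G : Plane → Plane} {x₀ : Plane} {C h : ℝ} {X : ℝ → Plane}

/-- Minus the velocity at time `t` forced by the path `X` looked up with delay `h`. -/
def delayedImpulse (G : Plane → Plane) (h : ℝ) (X : ℝ → Plane) (t : ℝ) : Plane :=
  t • ∫ θ in (0 : ℝ)..1, θ ^ 3 • G (X (max (t * θ - h) 0))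

/-- The integral operator whose fixed points for `h = 0` are the Nesterov flows. -/
def delayedStep (G : Plane → Plane) (x₀ : Plane) (h : ℝ) (X : ℝ → Plane) (t : ℝ) : Plane :=
  x₀ - ∫ τ in (0 : ℝ)..t, delayedImpulse G h X τ

/-- The substitution `s = t θ` in `t⁻³ ∫₀ᵗ s³ G(X(s)) ds` has removed the singularity at `t = 0`, so
continuity holds there too. -/
lemma delayedImpulse_continuous (hG : Continuous G) (hX : Continuous X) (h : ℝ) :
    Continuous (delayedImpulse G h X) := by
  refine continuous_id.smul
    (intervalIntegral.continuous_parametric_intervalIntegral_of_continuous' ?_ 0 1)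
  simp only [Function.uncurry_def]
  fun_prop

lemma delayedImpulse_norm_le (hC : ∀ x, ‖G x‖ ≤ C) (h : ℝ) (X : ℝ → Plane) (t : ℝ) :
    ‖delayedImpulse G h X t‖ ≤ C * |t| := by
  have hC0 : 0 ≤ C := (norm_nonneg _).trans (hC 0)
  rw [delayedImpulse, norm_smul, Real.norm_eq_abs, mul_comm]
  refine mul_le_mul_of_nonneg_right ?_ (abs_nonneg t)
  have := intervalIntegral.norm_integral_le_of_norm_le_const (a := 0) (b := 1) (C := C)
    (f := fun θ : ℝ => θ ^ 3 • G (X (max (t * θ - h) 0))) fun θ hθ => by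
      rw [uIoc_of_le zero_le_one] at hθ
      have h1 : θ ^ 3 ≤ 1 := pow_le_one₀ hθ.1.le hθ.2
      have h0 : 0 ≤ θ ^ 3 := pow_nonneg hθ.1.le 3
      rw [norm_smul, Real.norm_of_nonneg h0]
      nlinarith [hC (X (max (t * θ - h) 0)), norm_nonneg (G (X (max (t * θ - h) 0)))]
  simpa using this

lemma delayedStep_hasDerivAt (hG : Continuous G) (hX : Continuous X) (x₀ : Plane) (h t : ℝ) :
    HasDerivAt (delayedStep G x₀ h X) (-delayedImpulse G h X t) t :=
  ((delayedImpulse_continuous hG hX h).integral_hasStrictDerivAt 0 t).hasDerivAt.const_sub x₀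

lemma delayedStep_continuous (hG : Continuous G) (hX : Continuous X) (x₀ : Plane) (h : ℝ) :
    Continuous (delayedStep G x₀ h X) :=
  continuous_iff_continuousAt.2 fun t => (delayedStep_hasDerivAt hG hX x₀ h t).continuousAt

lemma delayedStep_zero (G : Plane → Plane) (x₀ : Plane) (h : ℝ) (X : ℝ → Plane) :
    delayedStep G x₀ h X 0 = x₀ := by simp [delayedStep]

lemma delayedStep_dist_le (hG : Continuous G) (hC : ∀ x, ‖G x‖ ≤ C) (hX : Continuous X)
    (x₀ : Plane) (h : ℝ) {T s t : ℝ} (hs : s ∈ Icc 0 T) (ht : t ∈ Icc 0 T) :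
    dist (delayedStep G x₀ h X s) (delayedStep G x₀ h X t) ≤ C * T * dist s t := by
  rw [dist_eq_norm, dist_eq_norm]
  have hC0 : 0 ≤ C := (norm_nonneg _).trans (hC 0)
  refine (convex_Icc 0 T).norm_image_sub_le_of_norm_hasDerivWithin_le
    (fun q _ => (delayedStep_hasDerivAt hG hX x₀ h q).hasDerivWithinAt) (fun q hq => ?_) ht hs
  rw [norm_neg]
  refine (delayedImpulse_norm_le hC h X q).trans ?_
  rw [abs_of_nonneg hq.1]
  exact mul_le_mul_of_nonneg_left hq.2 hC0

/-- With delay `h` the path is consulted only up to `max (T - h) 0`; hence each iteration gains an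
interval of length `h`. -/
lemma delayedImpulse_congr {X Y : ℝ → Plane} {t T : ℝ} (ht : t ∈ Icc 0 T)
    (hXY : ∀ s, 0 ≤ s → s ≤ max (T - h) 0 → X s = Y s) :
    delayedImpulse G h X t = delayedImpulse G h Y t := by
  rw [delayedImpulse, delayedImpulse]
  congr 1
  refine intervalIntegral.integral_congr fun θ hθ => ?_
  rw [uIcc_of_le zero_le_one] at hθ
  rw [hXY _ (le_max_right _ _) (max_le_max_right _ _)]
  nlinarith [hθ.1, hθ.2, ht.1, ht.2]

lemma delayedStep_congr {X Y : ℝ → Plane} {t T : ℝ} (ht : t ∈ Icc 0 T)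
    (hXY : ∀ s, 0 ≤ s → s ≤ max (T - h) 0 → X s = Y s) :
    delayedStep G x₀ h X t = delayedStep G x₀ h Y t := by
  rw [delayedStep, delayedStep]
  congr 1
  refine intervalIntegral.integral_congr fun τ hτ => ?_
  rw [uIcc_of_le ht.1] at hτ
  exact delayedImpulse_congr ⟨hτ.1, hτ.2.trans ht.2⟩ hXY

lemma delayedStep_iterate_continuous (hG : Continuous G) (x₀ : Plane) (h : ℝ) (k : ℕ) :
    Continuous ((delayedStep G x₀ h)^[k] fun _ => x₀) := by
  induction k with
  | zero => exact continuous_const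
  | succ k ih =>
    rw [Function.iterate_succ_apply']
    exact delayedStep_continuous hG ih x₀ h

lemma delayedStep_iterate_stable (hh : 0 ≤ h) (k : ℕ) : ∀ t, 0 ≤ t → t ≤ k * h →
    delayedStep G x₀ h ((delayedStep G x₀ h)^[k] fun _ => x₀) t
      = ((delayedStep G x₀ h)^[k] fun _ => x₀) t := by
  induction k with
  | zero =>
    intro t h0 h1
    have : t = 0 := le_antisymm (by simpa using h1) h0
    subst this
    simp [delayedStep_zero]
  | succ k ih =>
    intro t h0 h1
    rw [Function.iterate_succ_apply']
    refine delayedStep_congr (T := (k + 1) * h) ⟨h0, by exact_mod_cast h1⟩ fun s hs0 hs1 => ?_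
    refine ih s hs0 (hs1.trans ?_)
    rw [max_le_iff]
    exact ⟨by linarith, by positivity⟩

/-- Solutions of the delayed equation, valid on longer and longer intervals. -/
lemma exists_delayed_approximations (hG : Continuous G) (hC : ∀ x, ‖G x‖ ≤ C) (x₀ : Plane) :
    ∃ (X : ℕ → ℝ → Plane) (d : ℕ → ℝ), Tendsto d atTop (𝓝 0) ∧ (∀ n, Continuous (X n)) ∧
      (∀ n, X n 0 = x₀) ∧
      (∀ n T s t, s ∈ Icc 0 T → t ∈ Icc 0 T → dist (X n s) (X n t) ≤ C * T * dist s t) ∧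
      ∀ t, 0 ≤ t → ∀ᶠ n in atTop, X n t = delayedStep G x₀ (d n) (X n) t := by
  -- With delay `1 / (n + 1)`, `n² + 1` iterations are exact up to `(n² + 1) / (n + 1)`, which tends
  -- to infinity. The extra one makes every approximation a `delayedStep`, so its Lipschitz bound
  -- applies.
  refine ⟨fun n => (delayedStep G x₀ (1 / ((n : ℝ) + 1)))^[n * n + 1] fun _ => x₀,
    fun n => 1 / ((n : ℝ) + 1), tendsto_one_div_add_atTop_nhds_zero_nat,
    fun n => delayedStep_iterate_continuous hG _ _ _, fun n => ?_, fun n T s t hs ht => ?_,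
    fun t ht => ?_⟩
  · simp only [Function.iterate_succ_apply', delayedStep_zero]
  · simp only [Function.iterate_succ_apply']
    exact delayedStep_dist_le hG hC (delayedStep_iterate_continuous hG _ _ _) _ _ hs ht
  · filter_upwards [eventually_ge_atTop (Nat.ceil t + 1)] with n hn
    refine (delayedStep_iterate_stable (by positivity) _ t ht ?_).symm
    have h1 : t + 1 ≤ n := by
      have h2 := Nat.le_ceil t
      have : ((Nat.ceil t + 1 : ℕ) : ℝ) ≤ n := by exact_mod_cast hn
      push_cast at this
      linarith
    push_cast
    rw [mul_one_div, le_div_iff₀ (by positivity)]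
    nlinarith

/-- Arzelà–Ascoli by hand: Tychonoff gives convergence at the times `|q|` with `q` rational, and the
common Lipschitz bound on bounded intervals extends it to all nonnegative times. -/
lemma exists_subseq_tendsto {X : ℕ → ℝ → Plane}
    (h0 : ∀ n, X n 0 = x₀)
    (hL : ∀ n T s t, s ∈ Icc 0 T → t ∈ Icc 0 T → dist (X n s) (X n t) ≤ C * T * dist s t) :
    ∃ (φ : ℕ → ℕ) (Y : ℝ → Plane), StrictMono φ ∧
      ∀ t, 0 ≤ t → Tendsto (fun n => X (φ n) t) atTop (𝓝 (Y t)) := by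
  have hcpt : IsCompact (Set.pi univ fun q : ℚ =>
      Metric.closedBall x₀ (C * |(q : ℝ)| * |(q : ℝ)|)) :=
    isCompact_univ_pi fun q => isCompact_closedBall _ _
  obtain ⟨y, -, φ, hφ, hy⟩ := hcpt.tendsto_subseq (x := fun n (q : ℚ) => X n |(q : ℝ)|) fun n q _ => by
    have := hL n |(q : ℝ)| |(q : ℝ)| 0 ⟨abs_nonneg _, le_rfl⟩ ⟨le_rfl, abs_nonneg _⟩
    rw [h0] at this
    simpa using this
  rw [tendsto_pi_nhds] at hy
  have hcauchy : ∀ t, 0 ≤ t → CauchySeq fun n => X (φ n) t := by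
    intro t ht
    rw [Metric.cauchySeq_iff]
    intro η hη
    have hK : 0 < |C| * (t + 1) + 1 := by positivity
    obtain ⟨q, hq1, hq2⟩ := exists_rat_btwn
      (show t < t + min 1 (η / 3 / (|C| * (t + 1) + 1)) by
        have : 0 < min 1 (η / 3 / (|C| * (t + 1) + 1)) := lt_min one_pos (by positivity)
        linarith)
    have hq0 : (0 : ℝ) ≤ q := ht.trans hq1.le
    have hqt : (q : ℝ) ∈ Icc 0 (t + 1) :=
      ⟨hq0, by linarith [min_le_left 1 (η / 3 / (|C| * (t + 1) + 1))]⟩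
    have hclose : ∀ n, dist (X n t) (X n q) < η / 3 := by
      intro n
      have h1 := hL n (t + 1) t q ⟨ht, by linarith⟩ hqt
      have h2 : dist t q < η / 3 / (|C| * (t + 1) + 1) := by
        rw [dist_comm, Real.dist_eq, abs_of_pos (by linarith)]
        linarith [min_le_right 1 (η / 3 / (|C| * (t + 1) + 1))]
      rw [lt_div_iff₀ hK] at h2
      have h3 : C * (t + 1) * dist t q ≤ |C| * (t + 1) * dist t q := by
        gcongr; exact le_abs_self C
      nlinarith [dist_nonneg (x := t) (y := (q : ℝ))]
    obtain ⟨N, hN⟩ := Metric.cauchySeq_iff.1 (hy q).cauchySeq (η / 3) (by positivity)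
    refine ⟨N, fun m hm n hn => ?_⟩
    have h1 := hN m hm n hn
    simp only [Function.comp_apply, abs_of_nonneg hq0] at h1
    have h2 := hclose (φ m)
    have h3 := hclose (φ n)
    rw [dist_comm] at h3
    have h4 := dist_triangle4 (X (φ m) t) (X (φ m) q) (X (φ n) q) (X (φ n) t)
    linarith
  choose! Y hY using fun t ht => cauchySeq_tendsto_of_complete (hcauchy t ht)
  exact ⟨φ, Y, hφ, hY⟩

/-- Peano existence for the integral form of the flow. -/
lemma exists_fixedPoint (hG : Continuous G) (hC : ∀ x, ‖G x‖ ≤ C) (x₀ : Plane) :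
    ∃ Z : ℝ → Plane, Continuous Z ∧ delayedStep G x₀ 0 Z = Z := by
  have hC0 : 0 ≤ C := (norm_nonneg _).trans (hC 0)
  obtain ⟨X, d, hd, hXc, hX0, hXL, hXe⟩ := exists_delayed_approximations hG hC x₀
  obtain ⟨φ, Y, hφ, hY⟩ := exists_subseq_tendsto hX0 hXL
  have hYL : ∀ T s t, s ∈ Icc 0 T → t ∈ Icc 0 T → dist (Y s) (Y t) ≤ C * T * dist s t :=
    fun T s t hs ht => le_of_tendsto ((hY s hs.1).dist (hY t ht.1))
      (Eventually.of_forall fun n => hXL (φ n) T s t hs ht)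
  have hYc : ContinuousOn Y (Ici 0) := by
    intro t ht
    have ht : 0 ≤ t := ht
    have hlip : LipschitzOnWith (Real.toNNReal (C * (t + 1))) Y (Icc 0 (t + 1)) :=
      LipschitzOnWith.of_dist_le_mul fun s hs q hq => by
        rw [Real.coe_toNNReal _ (by positivity)]
        exact hYL (t + 1) s q hs hq
    refine (hlip.continuousOn t ⟨ht, by linarith⟩).mono_of_mem_nhdsWithin ?_
    rw [← Ici_inter_Iic]
    exact inter_mem self_mem_nhdsWithin (mem_nhdsWithin_of_mem_nhds (Iic_mem_nhds (by linarith)))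
  -- Convergence at moving times, needed because the delay shifts the argument by an amount that
  -- depends on `n`.
  have hlim : ∀ {u : ℕ → ℝ} {s : ℝ}, (∀ n, 0 ≤ u n) → 0 ≤ s → Tendsto u atTop (𝓝 s) →
      Tendsto (fun n => X (φ n) (u n)) atTop (𝓝 (Y s)) := by
    intro u s hu hs hus
    refine (hY s hs).congr_dist ?_
    have hb : Tendsto (fun n => C * (s + 1) * dist s (u n)) atTop (𝓝 0) := by
      simpa using ((tendsto_const_nhds (x := s)).dist hus).const_mul (C * (s + 1))
    refine squeeze_zero' (Eventually.of_forall fun n => dist_nonneg) ?_ hb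
    filter_upwards [hus.eventually (gt_mem_nhds (show s < s + 1 by linarith))] with n hn
    exact hXL (φ n) (s + 1) s (u n) ⟨hs, by linarith⟩ ⟨hu n, hn.le⟩
  have hdφ : Tendsto (fun n => d (φ n)) atTop (𝓝 0) := hd.comp hφ.tendsto_atTop
  have himp : ∀ τ, Tendsto (fun n => delayedImpulse G (d (φ n)) (X (φ n)) τ) atTop
      (𝓝 (delayedImpulse G 0 Y τ)) := by
    intro τ
    refine Tendsto.const_smul ?_ τ
    refine intervalIntegral.tendsto_integral_filter_of_dominated_convergence (fun _ => C)
      (Eventually.of_forall fun n => ?_) (Eventually.of_forall fun n => ae_of_all _ fun θ hθ => ?_)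
      intervalIntegrable_const (ae_of_all _ fun θ hθ => ?_)
    · have := hXc (φ n)
      exact Continuous.aestronglyMeasurable (by fun_prop)
    · rw [uIoc_of_le zero_le_one] at hθ
      have h1 : θ ^ 3 ≤ 1 := pow_le_one₀ hθ.1.le hθ.2
      have h0 : 0 ≤ θ ^ 3 := pow_nonneg hθ.1.le 3
      rw [norm_smul, Real.norm_of_nonneg h0]
      have := hC (X (φ n) (max (τ * θ - d (φ n)) 0))
      nlinarith [norm_nonneg (G (X (φ n) (max (τ * θ - d (φ n)) 0)))]
    · refine Tendsto.const_smul ((hG.tendsto _).comp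
        (hlim (fun n => le_max_right _ _) (le_max_right _ _) ?_)) _
      exact (hdφ.const_sub (τ * θ)).max tendsto_const_nhds
  have hfix : ∀ t, 0 ≤ t → Y t = delayedStep G x₀ 0 Y t := by
    intro t ht
    refine tendsto_nhds_unique (hY t ht) ?_
    refine Tendsto.congr' (f₁ := fun n => delayedStep G x₀ (d (φ n)) (X (φ n)) t) ?_ ?_
    · filter_upwards [hφ.tendsto_atTop.eventually (hXe t ht)] with n hn
      exact hn.symm
    · refine Tendsto.const_sub x₀ ?_
      refine intervalIntegral.tendsto_integral_filter_of_dominated_convergence (fun τ => C * |τ|)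
        (Eventually.of_forall fun n => ?_)
        (Eventually.of_forall fun n => ae_of_all _ fun τ _ => delayedImpulse_norm_le hC _ _ τ)
        (Continuous.intervalIntegrable (by fun_prop) _ _) (ae_of_all _ fun τ _ => himp τ)
      exact (delayedImpulse_continuous hG (hXc (φ n)) _).aestronglyMeasurable
  -- `Y` is controlled only at nonnegative times, the only ones the operator consults. Applying the
  -- operator once more gives a function on all of `ℝ` that is an exact fixed point.
  have hYm : Continuous fun t => Y (max t 0) :=
    hYc.comp_continuous (by fun_prop) fun t => le_max_right t 0
  have hstep : ∀ W : ℝ → Plane, (∀ s, 0 ≤ s → W s = Y s) →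
      delayedStep G x₀ 0 W = delayedStep G x₀ 0 Y := by
    intro W hW
    funext t
    simp only [delayedStep, delayedImpulse, hW _ (le_max_right _ _)]
  have e : delayedStep G x₀ 0 (fun t => Y (max t 0)) = delayedStep G x₀ 0 Y :=
    hstep _ fun s hs => by rw [max_eq_left hs]
  refine ⟨delayedStep G x₀ 0 Y, ?_, hstep _ fun s hs => (hfix s hs).symm⟩
  rw [← e]
  exact delayedStep_continuous hG hYm x₀ 0

/-- Undoing the substitution moves `t` into the upper limit, where the integral can be
differentiated without differentiating `G`. -/
lemma delayedImpulse_eq_of_pos (G : Plane → Plane) (X : ℝ → Plane) {t : ℝ} (ht : 0 < t) :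
    delayedImpulse G 0 X t = (t ^ 3)⁻¹ • ∫ s in (0 : ℝ)..t, s ^ 3 • G (X (max s 0)) := by
  have h1 := intervalIntegral.integral_comp_mul_left (a := 0) (b := 1)
    (fun s : ℝ => s ^ 3 • G (X (max s 0))) ht.ne'
  rw [mul_zero, mul_one] at h1
  have h2 : ∫ θ in (0 : ℝ)..1, (t * θ) ^ 3 • G (X (max (t * θ) 0))
      = t ^ 3 • ∫ θ in (0 : ℝ)..1, θ ^ 3 • G (X (max (t * θ - 0) 0)) := by
    rw [← intervalIntegral.integral_smul]
    simp only [mul_pow, smul_smul, sub_zero]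
  rw [h2] at h1
  have h3 : ∫ s in (0 : ℝ)..t, s ^ 3 • G (X (max s 0))
      = t ^ 4 • ∫ θ in (0 : ℝ)..1, θ ^ 3 • G (X (max (t * θ - 0) 0)) := by
    rw [pow_succ', mul_smul, h1, smul_inv_smul₀ ht.ne']
  rw [h3, smul_smul, delayedImpulse]
  congr 1
  field_simp

lemma delayedImpulse_hasDerivAt (hG : Continuous G) (hX : Continuous X) {t : ℝ} (ht : 0 < t) :
    HasDerivAt (delayedImpulse G 0 X) (-(3 / t) • delayedImpulse G 0 X t + G (X t)) t := by
  have hc : Continuous fun s : ℝ => s ^ 3 • G (X (max s 0)) := by fun_prop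
  have h1 := ((hasDerivAt_pow 3 t).inv (by positivity)).smul
    (hc.integral_hasStrictDerivAt 0 t).hasDerivAt
  refine (h1.congr_deriv ?_).congr_of_eventuallyEq ?_
  · rw [delayedImpulse_eq_of_pos G X ht, max_eq_left ht.le, smul_smul, smul_smul, add_comm]
    congr 1
    · congr 1
      push_cast
      field_simp
    · rw [Pi.inv_apply, inv_mul_cancel₀ (by positivity), one_smul]
  · filter_upwards [Ioi_mem_nhds ht] with s hs
    rw [delayedImpulse_eq_of_pos G X hs]
    rfl

theorem exists_isNesterovFlow_of_bounded {f : Plane → ℝ} (hf : ∀ x, HasGradientAt f (G x) x)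
    (hG : Continuous G) (hC : ∀ x, ‖G x‖ ≤ C) (x₀ : Plane) :
    ∃ X : ℝ → Plane, IsNesterovFlow f x₀ X := by
  obtain ⟨Z, hZ, hfix⟩ := exists_fixedPoint hG hC x₀
  have hd : ∀ t, HasDerivAt Z (-delayedImpulse G 0 Z t) t := fun t => by
    have := delayedStep_hasDerivAt hG hZ x₀ 0 t
    rwa [hfix] at this
  have hderiv : deriv Z = fun t => -delayedImpulse G 0 Z t := funext fun t => (hd t).deriv
  have himp := delayedImpulse_continuous hG hZ 0
  have hone : ContDiff ℝ 1 Z := by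
    rw [contDiff_one_iff_deriv]
    exact ⟨fun t => (hd t).differentiableAt, by rw [hderiv]; exact himp.neg⟩
  have hd2 : ∀ t, 0 < t → HasDerivAt (deriv Z)
      (-(-(3 / t) • delayedImpulse G 0 Z t + G (Z t))) t := fun t ht => by
    rw [hderiv]
    exact (delayedImpulse_hasDerivAt hG hZ ht).neg
  refine ⟨Z, hone.contDiffOn, ?_, ?_, ?_, fun t ht => ?_⟩
  · have : ContDiffOn ℝ (1 + 1) Z (Ioi 0) := by
      rw [contDiffOn_succ_iff_deriv_of_isOpen isOpen_Ioi]
      refine ⟨fun t _ => (hd t).differentiableAt.differentiableWithinAt, by simp, ?_⟩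
      rw [show (1 : WithTop ℕ∞) = 0 + 1 by simp, contDiffOn_succ_iff_deriv_of_isOpen isOpen_Ioi]
      refine ⟨fun t ht => (hd2 t ht).differentiableAt.differentiableWithinAt, by simp, ?_⟩
      rw [contDiffOn_zero]
      refine ContinuousOn.congr (f := fun t => -(-(3 / t) • delayedImpulse G 0 Z t + G (Z t)))
        ?_ fun t ht => (hd2 t ht).deriv
      refine ((ContinuousOn.smul (ContinuousOn.neg (continuousOn_const.div continuousOn_id
        fun t ht => ne_of_gt ht)) himp.continuousOn).add (hG.comp hZ).continuousOn).neg
    simpa [one_add_one_eq_two] using this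
  · rw [← hfix, delayedStep_zero]
  · rw [(hd 0).hasDerivWithinAt.derivWithin (uniqueDiffOn_Ici 0 0 (mem_Ici.2 le_rfl))]
    simp [delayedImpulse]
  · rw [(hd2 t ht).deriv, (hd t).deriv, (hf (Z t)).gradient]
    module

end Existence

/-! ### Existence for the unbounded push, by clipping. -/

/-- The perturbing force `ε (u - a)₊`, cut off at height `ε M`. -/
def clippedPush (ε a M u : ℝ) : ℝ := ε * min (max (u - a) 0) M

lemma clippedPush_continuous (ε a M : ℝ) : Continuous (clippedPush ε a M) := by
  unfold clippedPush; fun_prop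

lemma force_norm_le {ψ : ℝ → ℝ} {K : ℝ} (h : ∀ u, |ψ u| ≤ K) (x : Plane) :
    ‖force ψ x‖ ≤ 1 / 2 + K := by
  refine (norm_add_le _ _).trans (add_le_add ?_ ?_)
  · rw [centralForce_norm]; exact slope_le_half _
  · rw [PiLp.norm_single]; exact h _

theorem exists_isNesterovFlow_potential {ε : ℝ} (hε : 0 ≤ ε) {a : ℝ} (ha : 0 < a) :
    ∃ X : ℝ → Plane, IsNesterovFlow (potential ε a) !₂[2 * a, a] X := by
  set x₀ : Plane := !₂[2 * a, a] with hx₀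
  -- Energy decay gives `profile ‖X‖ ≤ profile ‖x₀‖ + ε a²`, and `profile_ge_linear` turns this into
  -- `‖X‖ ≤ M`: the clip is never active on the trajectory.
  set M := 1 + 2 * (profile ‖x₀‖ + ε * a * a) with hM
  have hp := profile_nonneg (norm_nonneg x₀)
  have hM0 : 0 ≤ M := by positivity
  set ψ := clippedPush ε a M with hψ
  have hψc : Continuous ψ := clippedPush_continuous ε a M
  have hψ0 : ∀ u, 0 ≤ ψ u := fun u => mul_nonneg hε (le_min (le_max_right _ _) hM0)
  set Ψ : ℝ → ℝ := fun u => ∫ v in a..u, ψ v with hΨ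
  have hΨd : ∀ u, HasDerivAt Ψ (ψ u) u := fun u =>
    (hψc.integral_hasStrictDerivAt a u).hasDerivAt
  have hΨm : Monotone Ψ := monotone_of_deriv_nonneg (fun u => (hΨd u).differentiableAt)
    fun u => by rw [(hΨd u).deriv]; exact hψ0 u
  have hΨa : Ψ a = 0 := by simp [hΨ]
  have hΨ0 : ∀ u, 0 ≤ Ψ u := by
    intro u
    rcases le_total a u with h | h
    · rw [← hΨa]; exact hΨm h
    · have : Ψ u = ∫ _ in a..u, (0 : ℝ) := by
        refine intervalIntegral.integral_congr fun v hv => ?_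
        rw [uIcc_of_ge h] at hv
        simp only [hψ, clippedPush]
        rw [max_eq_right (by linarith [hv.2]), min_eq_left hM0, mul_zero]
      rw [this]; simp
  have hΨ2 : Ψ (2 * a) ≤ ε * a * a := by
    have h1 : Ψ (2 * a) ≤ ∫ _ in a..(2 * a), ε * a := by
      refine intervalIntegral.integral_mono_on (by linarith) (hψc.intervalIntegrable _ _)
        (by simp) fun v hv => ?_
      refine mul_le_mul_of_nonneg_left ((min_le_left _ _).trans (max_le ?_ ha.le)) hε
      linarith [hv.2]
    refine h1.trans (le_of_eq ?_)
    rw [intervalIntegral.integral_const, smul_eq_mul]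
    ring
  have hG := hasGradientAt_generalPotential hΨd
  obtain ⟨X, hX⟩ := exists_isNesterovFlow_of_bounded hG (force_continuous hψc)
    (force_norm_le (K := ε * M) fun u => by
      rw [abs_of_nonneg (hψ0 u)]
      exact mul_le_mul_of_nonneg_left (min_le_right _ _) hε) x₀
  have hsol := hX.isSolution hG
  have hbound : ∀ t, 0 ≤ t → X t 0 - a ≤ M := by
    intro t ht
    have h1 := hsol.energy_antitoneOn hG (mem_Ici.2 le_rfl) ht ht
    simp only [hsol.initial_position, hsol.initial_velocity, generalPotential, norm_zero] at h1
    have h2 := profile_ge_linear ‖X t‖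
    have h3 := hΨ0 (X t 0)
    have h4 : Ψ (x₀ 0) ≤ ε * a * a := by simpa [hx₀] using hΨ2
    have h5 := IsSolution.coord_le_norm (X t) 0
    nlinarith [sq_nonneg ‖derivWithin X (Ici 0) t‖]
  refine ⟨X, hX.contDiffOn_one, hX.contDiffOn_two, hX.initial_position, hX.initial_velocity,
    fun t ht => ?_⟩
  have h1 := hX.ode t ht
  rw [(hG (X t)).gradient] at h1
  rw [(hasGradientAt_potential ε a (X t)).gradient]
  have : force (push ε a) (X t) = force ψ (X t) := by
    simp only [force, push, hψ, clippedPush]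
    rw [min_eq_left (max_le (hbound t ht.le) hM0)]
  rw [this, h1]

end NesterovFlow

end

/-! ### Assembly of the theorem. -/

theorem mainTheorem3 (a : ℝ) (ha : 0 < a) :
    (∃ ε₀ : ℝ, 0 < ε₀ ∧ ∀ ε : ℝ, 0 < ε → ε < ε₀ →
      (∃ X : ℝ → NesterovFlow.Plane,
        NesterovFlow.IsNesterovFlow (NesterovFlow.potential ε a) !₂[2 * a, a] X) ∧
      (∀ X : ℝ → NesterovFlow.Plane,
        NesterovFlow.IsNesterovFlow (NesterovFlow.potential ε a) !₂[2 * a, a] X →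
          0 < NesterovFlow.createdMomentum ε a X)) ∧
    (∀ ε : ℝ, 0 < ε →
      ConvexOn ℝ univ (NesterovFlow.potential ε a) ∧
      ContDiff ℝ 1 (NesterovFlow.potential ε a) ∧
      NesterovFlow.potential ε a 0 = 0 ∧
      (∀ x : NesterovFlow.Plane, x ≠ 0 → 0 < NesterovFlow.potential ε a x) ∧
      (∀ X : ℝ → NesterovFlow.Plane,
        NesterovFlow.IsNesterovFlow (NesterovFlow.potential ε a) !₂[2 * a, a] X →
          Tendsto X atTop (𝓝 0) ∧
          (0 < NesterovFlow.createdMomentum ε a X →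
            ∫⁻ t in Ioi (0 : ℝ), ENNReal.ofReal (t * NesterovFlow.potential ε a (X t)) = ⊤ ∧
            ∫⁻ t in Ioi (0 : ℝ), ENNReal.ofReal (t * ‖deriv X t‖ ^ 2) = ⊤))) := by
  obtain ⟨ε₀, hε₀, hκ⟩ := NesterovFlow.exists_small_perturbation ha
  refine ⟨⟨ε₀, hε₀, fun ε hε hlt => ⟨NesterovFlow.exists_isNesterovFlow_potential hε.le ha,
    fun X hX => hκ ε hε hlt X _ (hX.isSolution (NesterovFlow.hasGradientAt_potential ε a))⟩⟩,
    fun ε hε => ⟨NesterovFlow.convexOn_potential hε.le a, NesterovFlow.contDiff_potential ε a,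
      NesterovFlow.potential_zero ε ha.le, fun x hx => NesterovFlow.potential_pos hε.le a hx,
      fun X hX => ?_⟩⟩
  have hsol := hX.isSolution (NesterovFlow.hasGradientAt_potential ε a)
  refine ⟨hsol.tendsto_zero hε.le ha.le, fun hpos => ?_⟩
  obtain ⟨h1, h2⟩ := hsol.lintegral_eq_top hε.le ha hpos
  refine ⟨h1, ?_⟩
  rw [← h2]
  refine setLIntegral_congr_fun measurableSet_Ioi fun t ht => ?_
  simp only [NesterovFlow.derivWithin_Ici_eq_deriv ht]
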